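/- Let $f(x)=c_1+c_2x^{a_2}+c_3x^{a_3}\in\mathbb{Z}[x]$ with $0<a_2<a_3=:d$, all $c_i\in\{-H,\ldots,-1,1,\ldots,H\}$, $c_2<0<c_3$ and $c_1\neq 0$ of either sign. Call $f$ \emph{ill-conditioned} if $$\left|\left|\frac{c_2}{a_3}\right|\left|\frac{a_3-a_2}{c_1}\right|^{(a_3-a_2)/a_3}\left|\frac{a_2}{c_3}\right|^{a_2/a_3}-1\right|<\frac1{\log(dH)}$$ and $f$ has no degenerate real root (no real $\zeta$ with $f(\zeta)=f'(\zeta)=0$). A real $z_0$ is an \emph{approximate root} of $f$ (in the sense of Smale) with associated true root $\zeta$ if $f(\zeta)=0$ and the Newton iterates $z_{i+1}=z_i-g(z_i)/g'(z_i)$, where $g=f$ if $f'(\zeta)\neq0$ and $g=f'$ otherwise, are all defined (with $g'(z_i)\ne0$) and satisfy $|z_i-\zeta|\le(1/2)^{2^i-1}|z_0-\zeta|$ for all $i\geq 0$. Put $m=a_2$, $n=a_3$, $r_{m,n}=\dfrac{n}{m^{m/n}(n-m)^{(n-m)/n}}$, $c=\dfrac{|c_2|}{|c_1|^{(n-m)/n}\,|c_3|^{m/n}}$,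 and consider the series $$x_{\mathrm{low}}(c)=\frac1{c^{1/m}}\left[1+\sum_{k=1}^\infty\left(\frac1{km^k}\prod_{j=1}^{k-1}\frac{1+kn-jm}{j}\right)\left(\frac1{c^{n/m}}\right)^k\right],$$ $$x_{\mathrm{hi}}(c)=c^{\frac1{n-m}}\left[1-\sum_{k=1}^\infty\left(\frac1{k(n-m)^k}\prod_{j=1}^{k-1}\frac{km+j(n-m)-1}{j}\right)\left(\frac1{c^{n/(n-m)}}\right)^k\right],$$ $$x_{\mathrm{mid}}(c)=1+\sum_{k=1}^\infty\left(\frac1{kn^k}\prod_{j=1}^{k-1}\frac{1+km-jn}{j}\right)c^k,$$ and let $x^{(\ell)}_{\mathrm{low}},x^{(\ell)}_{\mathrm{hi}},x^{(\ell)}_{\mathrm{mid}}$ be obtained by restricting the sums to $1\le k\le\ell$. There is an absolute constant $K>0$ such that, for all such $f$ and $H$ with $f$ not ill-conditioned, and all integers $\ell\ge K\log^2(dH)$: (a) if $c_1>0$ and $c>r_{m,n}$, then the series for $x_{\mathrm{low}}(c)$ and $x_{\mathrm{hi}}(c)$ converge, and $|c_1/c_3|^{1/a_3}x^{(\ell)}_{\mathrm{low}}(c)$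 (resp. $|c_1/c_3|^{1/a_3}x^{(\ell)}_{\mathrm{hi}}(c)$) is an approximate root of $f$ with associated true root $|c_1/c_3|^{1/a_3}x_{\mathrm{low}}(c)$ (resp. $|c_1/c_3|^{1/a_3}x_{\mathrm{hi}}(c)$); (b) if $c_1<0$ and $c<r_{m,n}$, then the series for $x_{\mathrm{mid}}(c)$ converges, and $|c_1/c_3|^{1/a_3}x^{(\ell)}_{\mathrm{mid}}(c)$ is an approximate root of $f$ with associated true root $|c_1/c_3|^{1/a_3}x_{\mathrm{mid}}(c)$. In particular, $\ell=O(\log^2(dH))$ terms suffice. -/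

import Mathlib

open Polynomial

noncomputable section

/-- The trinomial `c₁ + c₂ x ^ a₂ + c₃ x ^ a₃` with integer coefficients, as a real polynomial. -/
def realTrinomial (a₂ a₃ : ℕ) (c₁ c₂ c₃ : ℤ) : ℝ[X] :=
  C (c₁ : ℝ) + C (c₂ : ℝ) * X ^ a₂ + C (c₃ : ℝ) * X ^ a₃

/-- `ζ` is a degenerate (that is, multiple) real root of `f`. -/
def IsDegenerateRoot (f : ℝ[X]) (ζ : ℝ) : Prop :=
  f.eval ζ = 0 ∧ f.derivative.eval ζ = 0

/-- `f = c₁ + c₂ x ^ a₂ + c₃ x ^ a₃`, with degree `a₃` and coefficients of absolute value at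
most `H`, is ill-conditioned. -/
def IllConditioned (H a₂ a₃ : ℕ) (c₁ c₂ c₃ : ℤ) : Prop :=
  |(|(c₂ : ℝ) / a₃| * |((a₃ : ℝ) - a₂) / c₁| ^ (((a₃ : ℝ) - a₂) / a₃)
      * |(a₂ : ℝ) / c₃| ^ ((a₂ : ℝ) / a₃)) - 1| < 1 / Real.log (a₃ * H) ∧
    ¬ ∃ ζ : ℝ, IsDegenerateRoot (realTrinomial a₂ a₃ c₁ c₂ c₃) ζ

/-- `z` is an approximate root of `f` in the sense of Smale, with associated true root `ζ`: the
Newton iterates `z₀ = z, z₁, z₂, …` (of `f`, or of `f'` if the root `ζ` is degenerate) are all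
defined, and `|zᵢ - ζ| ≤ (1/2)^(2^i - 1) |z₀ - ζ|` for all `i`. -/
def IsApproximateRoot (f : ℝ[X]) (z ζ : ℝ) : Prop :=
  f.eval ζ = 0 ∧
    ∃ g : ℝ[X], ((f.derivative.eval ζ ≠ 0 ∧ g = f) ∨
        (f.derivative.eval ζ = 0 ∧ g = f.derivative)) ∧
      ∃ w : ℕ → ℝ, w 0 = z ∧
        ∀ i, g.derivative.eval (w i) ≠ 0 ∧
          w (i + 1) = w i - g.eval (w i) / g.derivative.eval (w i) ∧
          |w i - ζ| ≤ (1 / 2 : ℝ) ^ (2 ^ i - 1) * |z - ζ|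

/-- The constant `r_{m,n} = n / (m ^ (m/n) * (n - m) ^ ((n-m)/n))`. -/
def rConst (m n : ℕ) : ℝ :=
  n / ((m : ℝ) ^ ((m : ℝ) / n) * ((n : ℝ) - m) ^ (((n : ℝ) - m) / n))

/-- The `k`-th term (`k ≥ 1`) of the series in the definition of `xLow`. -/
def lowTerm (m n : ℕ) (c : ℝ) (k : ℕ) : ℝ :=
  (1 / ((k : ℝ) * (m : ℝ) ^ k)
      * ∏ j ∈ Finset.Ico 1 k, (1 + (k : ℝ) * n - (j : ℝ) * m) / (j : ℝ))
    * (1 / c ^ ((n : ℝ) / m)) ^ k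

/-- The `k`-th term (`k ≥ 1`) of the series in the definition of `xHi`. -/
def hiTerm (m n : ℕ) (c : ℝ) (k : ℕ) : ℝ :=
  (1 / ((k : ℝ) * ((n : ℝ) - m) ^ k)
      * ∏ j ∈ Finset.Ico 1 k, ((k : ℝ) * m + (j : ℝ) * ((n : ℝ) - m) - 1) / (j : ℝ))
    * (1 / c ^ ((n : ℝ) / ((n : ℝ) - m))) ^ k

/-- The `k`-th term (`k ≥ 1`) of the series in the definition of `xMid`. -/
def midTerm (m n : ℕ) (c : ℝ) (k : ℕ) : ℝ :=
  (1 / ((k : ℝ) * (n : ℝ) ^ k)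
      * ∏ j ∈ Finset.Ico 1 k, (1 + (k : ℝ) * m - (j : ℝ) * n) / (j : ℝ))
    * c ^ k

def xLow (m n : ℕ) (c : ℝ) : ℝ :=
  1 / c ^ (1 / (m : ℝ)) * (1 + ∑' k : ℕ, lowTerm m n c (k + 1))

def xHi (m n : ℕ) (c : ℝ) : ℝ :=
  c ^ (1 / ((n : ℝ) - m)) * (1 - ∑' k : ℕ, hiTerm m n c (k + 1))

def xMid (m n : ℕ) (c : ℝ) : ℝ :=
  1 + ∑' k : ℕ, midTerm m n c (k + 1)

/-- The truncation of `xLow` to its terms of index at most `l`. -/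
def xLowTrunc (m n : ℕ) (c : ℝ) (l : ℕ) : ℝ :=
  1 / c ^ (1 / (m : ℝ)) * (1 + ∑ k ∈ Finset.Icc 1 l, lowTerm m n c k)

/-- The truncation of `xHi` to its terms of index at most `l`. -/
def xHiTrunc (m n : ℕ) (c : ℝ) (l : ℕ) : ℝ :=
  c ^ (1 / ((n : ℝ) - m)) * (1 - ∑ k ∈ Finset.Icc 1 l, hiTerm m n c k)

/-- The truncation of `xMid` to its terms of index at most `l`. -/
def xMidTrunc (m n : ℕ) (c : ℝ) (l : ℕ) : ℝ :=
  1 + ∑ k ∈ Finset.Icc 1 l, midTerm m n c k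

/-- The normalized middle coefficient `|c₂ / (c₁ ^ ((a₃-a₂)/a₃) * c₃ ^ (a₂/a₃))|`. -/
def normCoeff (a₂ a₃ : ℕ) (c₁ c₂ c₃ : ℤ) : ℝ :=
  |(c₂ : ℝ)| / (|(c₁ : ℝ)| ^ (((a₃ : ℝ) - a₂) / a₃) * |(c₃ : ℝ)| ^ ((a₂ : ℝ) / a₃))

/-- The rescaling factor `|c₁ / c₃| ^ (1 / a₃)`. -/
def rootScale (a₃ : ℕ) (c₁ c₃ : ℤ) : ℝ :=
  |(c₁ : ℝ) / (c₃ : ℝ)| ^ (1 / (a₃ : ℝ))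

end

/-! Scaling by `rootScale` turns `f` into `|c₁| (σ - c y ^ m + y ^ n)`, where `σ` is the sign of
`c₁`. The three series are then, up to a power of `c`, Fuss-Catalan series for powers `B ^ β` of the
solution of `B = 1 + z B ^ α`, with `α = n/m`, `n/(n-m)` or `m/n`. The Rothe-Hagen identity makes
these sums multiplicative in `β`, and a Pascal-type recurrence gives the functional equation, so the
sums are roots.

The coefficients grow at a rate governed by `r = rConst m n`, so the terms are at most `n ρ ^ k`,
with `ρ = r / c` or `c / r`. A degenerate root forces `c = r`; away from `c = r`, not being
ill-conditioned means `|c / r - 1| ≥ 1 / log Q` with `Q = d H`. Hence `ρ ≤ 1 - 1 / (log Q + 1)`. One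
logarithm in the bound on `ℓ` offsets this slow ratio, the other makes the error polynomially small
in `Q`.

The same separation, or the sign of `c₁` in the middle case, bounds the derivative at the root
below. A relative error of order `Q ^ (-4)` is then small enough for quadratic convergence of
Newton's method (`isApproximateRoot_of_abs_sub_le`). -/

/-! ### Fuss-Catalan coefficients and the Rothe-Hagen identity -/

/-- The `k`-th coefficient `β / (β + α k) * choose (β + α k) k` of the power series
`B ^ β`, where `B = 1 + z B ^ α`. -/
noncomputable def fussCatalan (α β : ℝ) : ℕ → ℝ
  | 0 => 1
  | k + 1 => β / ((k + 1).factorial : ℝ) *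
      ∏ j ∈ Finset.range k, (β + α * ((k : ℝ) + 1) - ((j : ℝ) + 1))

@[simp]
lemma fussCatalan_zero (α β : ℝ) : fussCatalan α β 0 = 1 := rfl

lemma fussCatalan_succ (α β : ℝ) (k : ℕ) :
    fussCatalan α β (k + 1) = β / ((k + 1).factorial : ℝ) *
      ∏ j ∈ Finset.range k, (β + α * ((k : ℝ) + 1) - ((j : ℝ) + 1)) := rfl

lemma fussCatalan_zero_succ (α : ℝ) (k : ℕ) : fussCatalan α 0 (k + 1) = 0 := by
  simp [fussCatalan_succ]

/-- Coefficient form of `B ^ (β + 1) = B ^ β + z B ^ (β + α)`. The three products share all but the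
end factors, as in Pascal's rule. -/
lemma fussCatalan_add_one (α β : ℝ) (k : ℕ) :
    fussCatalan α (β + 1) (k + 1) = fussCatalan α β (k + 1) + fussCatalan α (β + α) k := by
  cases k with
  | zero => simp [fussCatalan_succ]
  | succ k =>
    rw [fussCatalan_succ, fussCatalan_succ, fussCatalan_succ, Finset.prod_range_succ',
      Finset.prod_range_succ]
    have h1 : ∏ j ∈ Finset.range k,
        (β + 1 + α * (((k + 1 : ℕ) : ℝ) + 1) - (((j + 1 : ℕ) : ℝ) + 1)) =
        ∏ j ∈ Finset.range k, (β + α + α * ((k : ℝ) + 1) - ((j : ℝ) + 1)) :=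
      Finset.prod_congr rfl fun j _ => by push_cast; ring
    have h2 : ∏ j ∈ Finset.range k,
        (β + α * (((k + 1 : ℕ) : ℝ) + 1) - ((j : ℝ) + 1)) =
        ∏ j ∈ Finset.range k, (β + α + α * ((k : ℝ) + 1) - ((j : ℝ) + 1)) :=
      Finset.prod_congr rfl fun j _ => by push_cast; ring
    rw [h1, h2]
    have h3 : (((k + 1 + 1).factorial : ℕ) : ℝ) = ((k : ℝ) + 2) * ((k + 1).factorial : ℝ) := by
      rw [Nat.factorial_succ]; push_cast; ring
    have h4 : (((k + 1).factorial : ℕ) : ℝ) ≠ 0 := by positivity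
    have h5 : (k : ℝ) + 2 ≠ 0 := by positivity
    rw [h3]
    field_simp
    push_cast
    ring

lemma exists_polynomial_fussCatalan (α : ℝ) (k : ℕ) :
    ∃ p : ℝ[X], ∀ β, p.eval β = fussCatalan α β k := by
  cases k with
  | zero => exact ⟨1, fun β => by simp⟩
  | succ k =>
    refine ⟨C (1 / ((k + 1).factorial : ℝ)) * X *
      ∏ j ∈ Finset.range k, (X + C (α * ((k : ℝ) + 1) - ((j : ℝ) + 1))), fun β => ?_⟩
    rw [fussCatalan_succ, eval_mul, eval_prod]
    congr 1
    · simp; ring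
    · exact Finset.prod_congr rfl fun j _ => by simp; ring

/-- The Rothe-Hagen convolution identity. -/
lemma sum_antidiagonal_fussCatalan (α γ : ℝ) (k : ℕ) : ∀ β,
    ∑ ij ∈ Finset.HasAntidiagonal.antidiagonal k, fussCatalan α β ij.1 * fussCatalan α γ ij.2 =
      fussCatalan α (β + γ) k := by
  induction k with
  | zero => simp
  | succ k ih =>
    choose p hp using exists_polynomial_fussCatalan α
    -- The defect is a polynomial in `β`. By the recurrence and the induction hypothesis it has
    -- period 1, and it vanishes at 0, so it has infinitely many zeros.
    let q : ℝ[X] := ∑ ij ∈ Finset.HasAntidiagonal.antidiagonal (k + 1), p ij.1 * C (fussCatalan α γ ij.2) -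
      (p (k + 1)).comp (X + C γ)
    have hq (β : ℝ) : q.eval β = ∑ ij ∈ Finset.HasAntidiagonal.antidiagonal (k + 1),
        fussCatalan α β ij.1 * fussCatalan α γ ij.2 - fussCatalan α (β + γ) (k + 1) := by
      simp [q, eval_finsetSum, hp]
    have hstep (β : ℝ) : q.eval (β + 1) = q.eval β := by
      have h : β + 1 + γ = β + γ + 1 := by ring
      have h' : β + γ + α = β + α + γ := by ring
      rw [hq, hq, Finset.Nat.sum_antidiagonal_succ, Finset.Nat.sum_antidiagonal_succ, h,
        fussCatalan_add_one, h', ← ih (β + α)]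
      simp only [fussCatalan_add_one, add_mul, Finset.sum_add_distrib, fussCatalan_zero]
      ring
    have hnat (N : ℕ) : q.eval (N : ℝ) = 0 := by
      induction N with
      | zero =>
        rw [hq, Finset.Nat.sum_antidiagonal_succ]
        simp [fussCatalan_zero_succ]
      | succ N ihN => rw [Nat.cast_succ, hstep, ihN]
    have hq0 : q = 0 := by
      refine Polynomial.eq_zero_of_infinite_isRoot q ?_
      exact (Set.infinite_range_of_injective (Nat.cast_injective (R := ℝ))).mono
        (by rintro _ ⟨N, rfl⟩; exact hnat N)
    intro β
    have := hq β
    rw [hq0, eval_zero] at this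
    linarith

/-! ### Growth of the coefficients -/

/-- For integer `X` this bounds one term of the binomial theorem by the whole. For real `X`, the
derivative in `t` of the difference is a nonnegative multiple of the previous case at `X - 1`. -/
lemma prod_range_sub_mul_pow_le (k : ℕ) : ∀ X t : ℝ, (k : ℝ) ≤ X → 0 ≤ t →
    (∏ j ∈ Finset.range k, (X - j)) * t ^ k ≤ k.factorial * (1 + t) ^ X := by
  induction k with
  | zero =>
    intro X t hX ht
    simpa using Real.one_le_rpow (by linarith) (by simpa using hX)
  | succ k ih =>
    intro X t hX ht
    push_cast at hX
    have hk : (0 : ℝ) ≤ k := k.cast_nonneg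
    set P := ∏ j ∈ Finset.range (k + 1), (X - j) with hP
    have hP' : P = X * ∏ j ∈ Finset.range k, (X - 1 - j) := by
      rw [hP, Finset.prod_range_succ', mul_comm]
      congr 1
      · simp
      · exact Finset.prod_congr rfl fun j _ => by push_cast; ring
    let g : ℝ → ℝ := fun s => ((k + 1).factorial : ℝ) * (1 + s) ^ X - P * s ^ (k + 1)
    have hd (s : ℝ) (hs : 0 ≤ s) : HasDerivAt g (((k + 1).factorial : ℝ) *
        (X * (1 + s) ^ (X - 1)) - P * (((k : ℝ) + 1) * s ^ k)) s := by
      have h1 : HasDerivAt (fun s : ℝ => (1 + s) ^ X) (X * (1 + s) ^ (X - 1)) s := by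
        have := ((hasDerivAt_id s).const_add 1).rpow_const (p := X)
          (Or.inl (by simp; linarith))
        simpa using this
      have h2 : HasDerivAt (fun s : ℝ => s ^ (k + 1)) (((k : ℝ) + 1) * s ^ k) s := by
        simpa using hasDerivAt_pow (k + 1) s
      exact (h1.const_mul _).sub (h2.const_mul _)
    have hmono : MonotoneOn g (Set.Ici 0) := by
      refine monotoneOn_of_deriv_nonneg (convex_Ici 0)
        (fun s hs => (hd s hs).continuousAt.continuousWithinAt)
        (fun s hs => (hd s (interior_subset hs)).differentiableAt.differentiableWithinAt) ?_
      intro s hs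
      have hs0 : 0 ≤ s := interior_subset hs
      rw [(hd s hs0).deriv, hP']
      have h := ih (X - 1) s (by linarith) hs0
      have hX0 : 0 ≤ X * ((k : ℝ) + 1) := by nlinarith
      have := mul_le_mul_of_nonneg_left h hX0
      rw [Nat.factorial_succ]
      push_cast
      nlinarith
    have := hmono Set.self_mem_Ici ht ht
    simp only [g] at this
    simp only [ne_eq, Nat.add_eq_zero_iff, one_ne_zero, and_false, not_false_eq_true, zero_pow,
      mul_zero, sub_zero, add_zero, Real.one_rpow, mul_one] at this
    have h0 : (0 : ℝ) ≤ ((k + 1).factorial : ℝ) := by positivity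
    linarith

/-- The binomial bound is used at `t = 1 / (α - 1)`, the minimiser of `(1 + t) ^ α / t`. The lower
bound on `β` keeps every factor of the product nonnegative. -/
lemma abs_fussCatalan_le_of_one_lt {α β : ℝ} (hα : 1 < α) (hβ : 1 - α ≤ β) (hβ1 : |β| ≤ 1)
    (k : ℕ) :
    |fussCatalan α β (k + 1)| ≤ 1 / (α - 1) * ((α - 1) * (α / (α - 1)) ^ α) ^ (k + 1) := by
  have hα' : 0 < α - 1 := by linarith
  have hk : (0 : ℝ) ≤ k := k.cast_nonneg
  set X := β + α * ((k : ℝ) + 1) - 1 with hX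
  have hXk : (k : ℝ) ≤ X := by nlinarith
  have hb := prod_range_sub_mul_pow_le k X (1 / (α - 1)) hXk (by positivity)
  have hq : 1 + 1 / (α - 1) = α / (α - 1) := by field_simp; ring
  have hprod : ∏ j ∈ Finset.range k, (β + α * ((k : ℝ) + 1) - ((j : ℝ) + 1)) =
      ∏ j ∈ Finset.range k, (X - j) := Finset.prod_congr rfl fun j _ => by rw [hX]; ring
  have hnn : 0 ≤ ∏ j ∈ Finset.range k, (X - j) := by
    refine Finset.prod_nonneg fun j hj => ?_
    have : (j : ℝ) ≤ k := by exact_mod_cast (Finset.mem_range.mp hj).le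
    linarith
  rw [fussCatalan_succ, hprod, abs_mul, abs_of_nonneg hnn, abs_div,
    abs_of_pos (by positivity : (0 : ℝ) < ((k + 1).factorial : ℝ))]
  rw [hq, div_pow, one_pow, mul_one_div, div_le_iff₀ (by positivity)] at hb
  have hq1 : 1 ≤ α / (α - 1) := by rw [le_div_iff₀ hα']; linarith
  have hpow : (α / (α - 1)) ^ X ≤ ((α / (α - 1)) ^ α) ^ (k + 1) := by
    rw [← Real.rpow_mul_natCast (by positivity)]
    refine Real.rpow_le_rpow_of_exponent_le hq1 ?_
    push_cast
    have := le_abs_self β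
    linarith
  have hfac : (k.factorial : ℝ) ≤ ((k + 1).factorial : ℝ) := by
    exact_mod_cast Nat.factorial_le (Nat.le_succ k)
  calc |β| / ((k + 1).factorial : ℝ) * ∏ j ∈ Finset.range k, (X - j)
      ≤ 1 / ((k + 1).factorial : ℝ) *
        (((k + 1).factorial : ℝ) * ((α / (α - 1)) ^ α) ^ (k + 1) * (α - 1) ^ k) := by
        gcongr
        exact hb.trans (by gcongr)
    _ = 1 / (α - 1) * ((α - 1) * (α / (α - 1)) ^ α) ^ (k + 1) := by
        rw [mul_pow, pow_succ (α - 1)]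
        field_simp

/-- The first `p` factors are nonnegative and at most `p, …, 1`; the last `q` are nonpositive and at
most `1, …, q` in absolute value. -/
lemma abs_prod_range_sub_le {θ : ℝ} (h0 : 0 ≤ θ) (h1 : θ ≤ 1) (p q : ℕ) :
    |∏ j ∈ Finset.range (p + q), ((p : ℝ) + θ - ((j : ℝ) + 1))| ≤
      p.factorial * q.factorial := by
  induction p with
  | zero =>
    simp only [zero_add]
    induction q with
    | zero => simp
    | succ q ih =>
      rw [Finset.prod_range_succ, abs_mul]
      have hq : (0 : ℝ) ≤ q := q.cast_nonneg
      have h2 : |((0 : ℕ) : ℝ) + θ - ((q : ℝ) + 1)| ≤ (q : ℝ) + 1 := by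
        rw [abs_le]; constructor <;> push_cast <;> linarith
      calc _ ≤ (((0 : ℕ).factorial : ℝ) * q.factorial) * ((q : ℝ) + 1) :=
            mul_le_mul ih h2 (abs_nonneg _) (by positivity)
        _ = _ := by rw [Nat.factorial_succ q]; push_cast; ring
  | succ p ih =>
    rw [show p + 1 + q = (p + q) + 1 by ring, Finset.prod_range_succ', abs_mul]
    have hp : (0 : ℝ) ≤ p := p.cast_nonneg
    have h2 : |((p + 1 : ℕ) : ℝ) + θ - (((0 : ℕ) : ℝ) + 1)| ≤ (p : ℝ) + 1 := by
      rw [abs_le]; constructor <;> push_cast <;> linarith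
    have h3 : ∏ j ∈ Finset.range (p + q), (((p + 1 : ℕ) : ℝ) + θ - (((j + 1 : ℕ) : ℝ) + 1)) =
        ∏ j ∈ Finset.range (p + q), ((p : ℝ) + θ - ((j : ℝ) + 1)) :=
      Finset.prod_congr rfl fun j _ => by push_cast; ring
    rw [h3]
    calc _ ≤ ((p.factorial : ℝ) * q.factorial) * ((p : ℝ) + 1) :=
          mul_le_mul ih h2 (abs_nonneg _) (by positivity)
      _ = _ := by rw [Nat.factorial_succ p]; push_cast; ring

/-- The mode of a binomial distribution on `N + 1` points has probability at least
`1 / (N + 1)`. -/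
lemma one_le_mul_binomial_mode {α : ℝ} (h0 : 0 < α) (h1 : α < 1) {N p : ℕ} (hpN : p ≤ N)
    (hp : (p : ℝ) ≤ α * (N + 1)) (hp' : α * (N + 1) ≤ p + 1) :
    1 ≤ ((N : ℝ) + 1) * (N.choose p * α ^ p * (1 - α) ^ (N - p)) := by
  have h1' : 0 < 1 - α := by linarith
  -- The terms rise up to `p` and fall after it, since `p` is essentially the integer part of `α (N
  -- + 1)`. The `N + 1` terms sum to 1, so the largest is at least the average.
  let T : ℕ → ℝ := fun i => N.choose i * α ^ i * (1 - α) ^ (N - i)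
  have hT (i : ℕ) : 0 ≤ T i := by positivity
  have hrec (i : ℕ) (hi : i < N) :
      T (i + 1) * (((i : ℝ) + 1) * (1 - α)) = T i * (((N : ℝ) - i) * α) := by
    have h := Nat.choose_succ_right_eq N i
    have h' : (N.choose (i + 1) : ℝ) * ((i : ℝ) + 1) = N.choose i * ((N : ℝ) - i) := by
      rw [← Nat.cast_sub hi.le]; exact_mod_cast h
    have hs : N - i = (N - (i + 1)) + 1 := by omega
    simp only [T]
    rw [hs, pow_succ α, pow_succ (1 - α)]
    linear_combination (α ^ i * α * (1 - α) ^ (N - (i + 1)) * (1 - α)) * h'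
  have hup (i : ℕ) (hi : i < p) : T i ≤ T (i + 1) := by
    have hi' : (i : ℝ) + 1 ≤ p := by exact_mod_cast hi
    have h := hrec i (by omega)
    have h2 : ((i : ℝ) + 1) * (1 - α) ≤ ((N : ℝ) - i) * α := by nlinarith
    refine le_of_mul_le_mul_right (a := ((i : ℝ) + 1) * (1 - α)) ?_ (by positivity)
    rw [h]
    exact mul_le_mul_of_nonneg_left h2 (hT i)
  have hdown (i : ℕ) (hi : p ≤ i) (hiN : i < N) : T (i + 1) ≤ T i := by
    have hi' : (p : ℝ) ≤ i := by exact_mod_cast hi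
    have h := hrec i hiN
    have h2 : ((N : ℝ) - i) * α ≤ ((i : ℝ) + 1) * (1 - α) := by nlinarith
    refine le_of_mul_le_mul_right (a := ((i : ℝ) + 1) * (1 - α)) ?_ (by positivity)
    rw [h]
    exact mul_le_mul_of_nonneg_left h2 (hT i)
  have hle1 (i : ℕ) (hi : i ≤ p) : T i ≤ T p := by
    induction hi using Nat.decreasingInduction with
    | self => exact le_rfl
    | of_succ i hi ih => exact (hup i hi).trans ih
  have hle2 (i : ℕ) (hi : p ≤ i) : i ≤ N → T i ≤ T p := by
    induction i, hi using Nat.le_induction with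
    | base => exact fun _ => le_rfl
    | succ i hi ih => exact fun h => (hdown i hi (by omega)).trans (ih (by omega))
  have hsum : ∑ i ∈ Finset.range (N + 1), T i = 1 := by
    have := add_pow α (1 - α) N
    rw [add_sub_cancel, one_pow] at this
    rw [this]
    exact Finset.sum_congr rfl fun i _ => by simp only [T]; ring
  calc (1 : ℝ) = ∑ i ∈ Finset.range (N + 1), T i := hsum.symm
    _ ≤ ∑ _i ∈ Finset.range (N + 1), T p := by
        refine Finset.sum_le_sum fun i hi => ?_
        rcases le_total i p with h | h
        · exact hle1 i h
        · exact hle2 i h (by have := Finset.mem_range.mp hi; omega)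
    _ = ((N : ℝ) + 1) * T p := by simp

/-- For `α < 1` the factors change sign, near `p = ⌊α (k + 1)⌋`. The product is at most `p! (k - p)!
= k! / choose k p`, and the binomial mode bounds this by `(k + 1)! α ^ p (1 - α) ^ (k - p)`. -/
lemma abs_fussCatalan_le_of_lt {m n : ℕ} (hm : 0 < m) (hmn : m < n) (k : ℕ) :
    |fussCatalan ((m : ℝ) / n) (1 / n) (k + 1)| ≤
      n * (((m : ℝ) / n) ^ ((m : ℝ) / n) * (1 - (m : ℝ) / n) ^ (1 - (m : ℝ) / n)) ^ (k + 1) := by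
  have hm1 : (1 : ℝ) ≤ m := by exact_mod_cast hm
  have hmn1 : (m : ℝ) + 1 ≤ n := by exact_mod_cast hmn
  have hn0 : (0 : ℝ) < n := by linarith
  set α : ℝ := (m : ℝ) / n with hα
  have h0 : 0 < α := by positivity
  have h1 : α < 1 := by rw [hα, div_lt_one hn0]; linarith
  have h1' : 0 < 1 - α := by linarith
  set p := (k + 1) * m / n with hp
  set s := (k + 1) * m % n with hs
  have hn : 0 < n := by omega
  have hsn : s < n := Nat.mod_lt _ hn
  have hdiv : n * p + s = (k + 1) * m := Nat.div_add_mod _ _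
  have hpk : p ≤ k := by
    have : p < k + 1 := by
      rw [hp, Nat.div_lt_iff_lt_mul hn]
      exact Nat.mul_lt_mul_of_pos_left hmn (Nat.succ_pos k)
    omega
  have hdivR : (n : ℝ) * p + s = (k + 1) * m := by exact_mod_cast hdiv
  have hsnR : (s : ℝ) + 1 ≤ n := by exact_mod_cast hsn
  have hαk : α * ((k : ℝ) + 1) = p + s / n := by
    rw [hα]; field_simp; linarith
  have hsn0 : (0 : ℝ) ≤ (s : ℝ) / n := by positivity
  -- The remainder satisfies `s ≤ n - 1`, which leaves just enough room for `β = 1 / n`.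
  have hθ : (s : ℝ) / n + 1 / n ≤ 1 := by rw [← add_div, div_le_one hn0]; exact hsnR
  have hinv : (0 : ℝ) ≤ 1 / (n : ℝ) := by positivity
  have hprod := abs_prod_range_sub_le (θ := (s : ℝ) / n + 1 / n) (by positivity) hθ p (k - p)
  rw [Nat.add_sub_cancel' hpk] at hprod
  have hprod' : ∏ j ∈ Finset.range k, (1 / (n : ℝ) + α * ((k : ℝ) + 1) - ((j : ℝ) + 1)) =
      ∏ j ∈ Finset.range k, ((p : ℝ) + (s / n + 1 / n) - ((j : ℝ) + 1)) :=
    Finset.prod_congr rfl fun j _ => by rw [hαk]; ring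
  have hmode := one_le_mul_binomial_mode h0 h1 hpk (by linarith) (by linarith)
  have hfac : (k.choose p : ℝ) * p.factorial * (k - p).factorial = k.factorial := by
    exact_mod_cast Nat.choose_mul_factorial_mul_factorial hpk
  have hfac' : (p.factorial : ℝ) * (k - p).factorial ≤
      ((k + 1).factorial : ℝ) * (α ^ p * (1 - α) ^ (k - p)) := by
    have := mul_le_mul_of_nonneg_left hmode
      (by positivity : (0 : ℝ) ≤ (p.factorial : ℝ) * (k - p).factorial)
    rw [mul_one] at this
    refine this.trans (le_of_eq ?_)
    rw [Nat.factorial_succ, Nat.cast_mul, ← hfac]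
    push_cast
    ring
  have hpow1 : α ^ p ≤ 1 / α * (α ^ α) ^ (k + 1) := by
    have : 1 / α * (α ^ α) ^ (k + 1) = α ^ (α * ((k : ℝ) + 1) - 1) := by
      rw [← Real.rpow_mul_natCast h0.le, Real.rpow_sub h0, Real.rpow_one]
      push_cast
      ring
    rw [this, ← Real.rpow_natCast]
    exact Real.rpow_le_rpow_of_exponent_ge h0 h1.le (by linarith)
  have hpow2 : (1 - α) ^ (k - p) ≤ 1 / (1 - α) * ((1 - α) ^ (1 - α)) ^ (k + 1) := by
    have : 1 / (1 - α) * ((1 - α) ^ (1 - α)) ^ (k + 1) =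
        (1 - α) ^ ((1 - α) * ((k : ℝ) + 1) - 1) := by
      rw [← Real.rpow_mul_natCast h1'.le, Real.rpow_sub h1', Real.rpow_one]
      push_cast
      ring
    rw [this, ← Real.rpow_natCast]
    refine Real.rpow_le_rpow_of_exponent_ge h1' (by linarith) ?_
    rw [Nat.cast_sub hpk]
    linarith
  have hconst : 1 / (n : ℝ) * (1 / α * (1 / (1 - α))) ≤ n := by
    have : 1 / (n : ℝ) * (1 / α * (1 / (1 - α))) = n / (m * (n - m)) := by
      have : (n : ℝ) - m ≠ 0 := by linarith
      have h3 : 1 - α = ((n : ℝ) - m) / n := by rw [hα]; field_simp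
      rw [h3, hα]
      field_simp
    rw [this]
    exact div_le_self hn0.le (by nlinarith)
  rw [fussCatalan_succ, hprod', abs_mul, abs_of_nonneg (by positivity)]
  calc 1 / (n : ℝ) / ((k + 1).factorial : ℝ) * _
      ≤ 1 / (n : ℝ) / ((k + 1).factorial : ℝ) *
        (((k + 1).factorial : ℝ) * ((1 / α * (α ^ α) ^ (k + 1)) *
          (1 / (1 - α) * ((1 - α) ^ (1 - α)) ^ (k + 1)))) := by
        gcongr
        refine hprod.trans (hfac'.trans ?_)
        gcongr
    _ = (1 / (n : ℝ) * (1 / α * (1 / (1 - α)))) * (α ^ α * (1 - α) ^ (1 - α)) ^ (k + 1) := by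
        rw [mul_pow]
        field_simp
    _ ≤ _ := by gcongr

/-! ### The Fuss-Catalan series and its functional equation -/

/-- Absolute convergence of the Fuss-Catalan series at `z`. -/
def FussCatalanConv (α β z : ℝ) : Prop :=
  Summable fun k : ℕ => ‖fussCatalan α β k * z ^ k‖

/-- The sum of the Fuss-Catalan series: the power `B ^ β` of the solution of
`B = 1 + z B ^ α`. -/
noncomputable def fussCatalanSum (α β z : ℝ) : ℝ :=
  ∑' k : ℕ, fussCatalan α β k * z ^ k

lemma sum_antidiagonal_fussCatalan_mul_pow (α β γ z : ℝ) (k : ℕ) :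
    ∑ ij ∈ Finset.HasAntidiagonal.antidiagonal k,
      fussCatalan α β ij.1 * z ^ ij.1 * (fussCatalan α γ ij.2 * z ^ ij.2) =
      fussCatalan α (β + γ) k * z ^ k := by
  rw [← sum_antidiagonal_fussCatalan, Finset.sum_mul]
  refine Finset.sum_congr rfl fun ij hij => ?_
  rw [← Finset.HasAntidiagonal.mem_antidiagonal.mp hij, pow_add]
  ring

lemma FussCatalanConv.add {α β γ z : ℝ} (hβ : FussCatalanConv α β z)
    (hγ : FussCatalanConv α γ z) : FussCatalanConv α (β + γ) z := by
  have := summable_norm_sum_mul_antidiagonal_of_summable_norm hβ hγ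
  simp only [sum_antidiagonal_fussCatalan_mul_pow] at this
  exact this

lemma fussCatalanSum_add {α β γ z : ℝ} (hβ : FussCatalanConv α β z)
    (hγ : FussCatalanConv α γ z) :
    fussCatalanSum α (β + γ) z = fussCatalanSum α β z * fussCatalanSum α γ z := by
  have := tsum_mul_tsum_eq_tsum_sum_antidiagonal_of_summable_norm hβ hγ
  simp only [sum_antidiagonal_fussCatalan_mul_pow] at this
  exact this.symm

lemma fussCatalanConv_zero (α z : ℝ) : FussCatalanConv α 0 z := by
  refine summable_of_ne_finset_zero (s := {0}) fun k hk => ?_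
  obtain ⟨j, rfl⟩ := Nat.exists_eq_succ_of_ne_zero (by simpa using hk)
  simp [fussCatalan_zero_succ]

lemma fussCatalanSum_zero (α z : ℝ) : fussCatalanSum α 0 z = 1 := by
  unfold fussCatalanSum
  rw [tsum_eq_single 0]
  · simp
  · intro k hk
    obtain ⟨j, rfl⟩ := Nat.exists_eq_succ_of_ne_zero hk
    simp [fussCatalan_zero_succ]

lemma FussCatalanConv.nat_mul {α β z : ℝ} (hβ : FussCatalanConv α β z) (j : ℕ) :
    FussCatalanConv α (j * β) z ∧ fussCatalanSum α (j * β) z = fussCatalanSum α β z ^ j := by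
  induction j with
  | zero => simpa using ⟨fussCatalanConv_zero α z, fussCatalanSum_zero α z⟩
  | succ j ih =>
    rw [Nat.cast_succ, add_mul, one_mul]
    exact ⟨ih.1.add hβ, by rw [fussCatalanSum_add ih.1 hβ, ih.2, pow_succ]⟩

lemma FussCatalanConv.sum_eq {α β z : ℝ} (h : FussCatalanConv α β z) :
    fussCatalanSum α β z = 1 + ∑' k : ℕ, fussCatalan α β (k + 1) * z ^ (k + 1) := by
  unfold fussCatalanSum
  rw [Summable.tsum_eq_zero_add (Summable.of_norm h)]
  simp

lemma fussCatalanSum_add_one {α β z : ℝ} (h : FussCatalanConv α β z)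
    (h1 : FussCatalanConv α (β + 1) z) (hα : FussCatalanConv α (β + α) z) :
    fussCatalanSum α (β + 1) z = fussCatalanSum α β z + z * fussCatalanSum α (β + α) z := by
  have hs := (summable_nat_add_iff 1).mpr (Summable.of_norm h)
  have hs' := (Summable.of_norm hα).mul_left z
  rw [h1.sum_eq, h.sum_eq]
  unfold fussCatalanSum
  rw [← tsum_mul_left, add_assoc, ← hs.tsum_add hs']
  congr 2
  ext k
  rw [fussCatalan_add_one]
  ring

/-- The sum is `B ^ β`, so its powers `a` and `b` are `B` and `B ^ α`; the recurrence at exponent 0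
reads `B = 1 + z B ^ α`. -/
lemma FussCatalanConv.pow_eq_one_add {α β z : ℝ} (h : FussCatalanConv α β z) {a b : ℕ}
    (ha : a * β = 1) (hb : b * β = α) :
    fussCatalanSum α β z ^ a = 1 + z * fussCatalanSum α β z ^ b := by
  obtain ⟨ha1, ha2⟩ := h.nat_mul a
  obtain ⟨hb1, hb2⟩ := h.nat_mul b
  rw [← ha2, ← hb2, ha, hb]
  rw [ha] at ha1
  rw [hb] at hb1
  have := fussCatalanSum_add_one (fussCatalanConv_zero α z) (by simpa using ha1)
    (by simpa using hb1)
  simpa [fussCatalanSum_zero] using this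

/-- The recurrence at exponent `-α`: `B ^ (1 - α) = B ^ (-α) + z`. This variant serves the negative
`β` of the series for `xHi`. -/
lemma FussCatalanConv.pow_eq_pow_add {α β z : ℝ} (h : FussCatalanConv α β z) {a b : ℕ}
    (ha : a * β = 1 - α) (hb : b * β = -α) :
    fussCatalanSum α β z ^ a = fussCatalanSum α β z ^ b + z := by
  obtain ⟨ha1, ha2⟩ := h.nat_mul a
  obtain ⟨hb1, hb2⟩ := h.nat_mul b
  rw [← ha2, ← hb2, ha, hb]
  rw [ha, sub_eq_neg_add] at ha1
  rw [hb] at hb1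
  have := fussCatalanSum_add_one hb1 ha1 (by simpa using fussCatalanConv_zero α z)
  simpa [fussCatalanSum_zero, sub_eq_neg_add] using this

lemma FussCatalanConv.sum_mul_sum_neg {α β z : ℝ} (h : FussCatalanConv α β z)
    (h' : FussCatalanConv α (-β) z) :
    fussCatalanSum α β z * fussCatalanSum α (-β) z = 1 := by
  rw [← fussCatalanSum_add h h', add_neg_cancel, fussCatalanSum_zero]

lemma FussCatalanConv.mono {α β z w : ℝ} (h : FussCatalanConv α β z) (hw : 0 ≤ w)
    (hwz : w ≤ z) : FussCatalanConv α β w := by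
  refine Summable.of_nonneg_of_le (fun _ => norm_nonneg _) (fun k => ?_) h
  rw [norm_mul, norm_mul, norm_pow, norm_pow, Real.norm_of_nonneg hw,
    Real.norm_of_nonneg (hw.trans hwz)]
  gcongr

/-- For `α < 1` coefficients can be negative, so positivity is not termwise. A nonpositive value
would give, by continuity from 0, a zero of the sum, where the functional equation reads `0 = 1`. -/
lemma FussCatalanConv.sum_pos {α β z : ℝ} (h : FussCatalanConv α β z) (hz : 0 ≤ z) {a b : ℕ}
    (ha0 : a ≠ 0) (hb0 : b ≠ 0) (ha : a * β = 1) (hb : b * β = α) :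
    0 < fussCatalanSum α β z := by
  by_contra! hle
  have hcont : ContinuousOn (fussCatalanSum α β) (Set.Icc 0 z) := by
    refine continuousOn_tsum (fun k => by fun_prop) h fun k w hw => ?_
    rw [norm_mul, norm_mul, norm_pow, norm_pow, Real.norm_of_nonneg hw.1,
      Real.norm_of_nonneg hz]
    have := hw.1
    have := hw.2
    gcongr
  have h0 : 0 ≤ fussCatalanSum α β 0 := by
    unfold fussCatalanSum
    rw [tsum_eq_single 0 fun k hk => by simp [hk]]
    simp
  obtain ⟨w, hw, hw0⟩ := intermediate_value_Icc' hz hcont ⟨hle, h0⟩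
  have := (h.mono hw.1 hw.2).pow_eq_one_add ha hb
  rw [hw0] at this
  simp [ha0, hb0] at this

/-! ### Tails of geometrically bounded series -/

section Tail

variable {a : ℕ → ℝ} {C ρ : ℝ}

lemma summable_norm_of_geometric_bound (h0 : 0 ≤ ρ) (h1 : ρ < 1)
    (ha : ∀ k, |a (k + 1)| ≤ C * ρ ^ (k + 1)) : Summable fun k => ‖a (k + 1)‖ := by
  refine Summable.of_nonneg_of_le (fun _ => norm_nonneg _) (fun k => ha k) ?_
  exact ((summable_nat_add_iff 1).mpr (summable_geometric_of_lt_one h0 h1)).mul_left C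

lemma abs_tsum_sub_sum_Icc_le (hC : 0 ≤ C) (h0 : 0 ≤ ρ) (h1 : ρ < 1)
    (ha : ∀ k, |a (k + 1)| ≤ C * ρ ^ (k + 1)) (l : ℕ) :
    |∑' k, a (k + 1) - ∑ k ∈ Finset.Icc 1 l, a k| ≤ C * ρ ^ l / (1 - ρ) := by
  have hs := summable_norm_of_geometric_bound h0 h1 ha
  have hIcc : ∑ k ∈ Finset.Icc 1 l, a k = ∑ k ∈ Finset.range l, a (k + 1) := by
    rw [Finset.range_eq_Ico, Finset.sum_Ico_add' a 0 l 1]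
    rfl
  have hb (k : ℕ) : ‖a (k + l + 1)‖ ≤ C * ρ * ρ ^ l * ρ ^ k :=
    (ha (k + l)).trans (le_of_eq (by ring))
  have hgeo := (hasSum_geometric_of_lt_one h0 h1).mul_left (C * ρ * ρ ^ l)
  rw [hIcc, ← (Summable.of_norm hs).sum_add_tsum_nat_add l, add_sub_cancel_left]
  refine (tsum_of_norm_bounded hgeo hb).trans ?_
  rw [div_eq_mul_inv]
  have hinv : 0 ≤ (1 - ρ)⁻¹ := inv_nonneg.mpr (by linarith)
  refine mul_le_mul_of_nonneg_right (mul_le_mul_of_nonneg_right ?_ (by positivity)) hinv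
  nlinarith

end Tail

/-! ### Quadratic convergence of Newton's method -/

lemma abs_eval_sub_eval_le {f : ℝ[X]} {F a b : ℝ}
    (hF : ∀ x ∈ Set.uIcc a b, |f.derivative.eval x| ≤ F) :
    |f.eval b - f.eval a| ≤ F * |b - a| := by
  have := Convex.norm_image_sub_le_of_norm_hasDerivWithin_le (f := fun x => f.eval x)
    (f' := fun x => f.derivative.eval x) (s := Set.uIcc a b) (C := F)
    (fun x _ => (f.hasDerivAt x).hasDerivWithinAt) hF (convex_uIcc a b)
    Set.left_mem_uIcc Set.right_mem_uIcc
  simpa using this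

/-- Over the interval `f'` moves by at most `|f'(ζ)| / 4`, so `|f'(x)| ≥ |f'(ζ)| / 2`. -/
lemma abs_newton_sub_le {f : ℝ[X]} {ζ x F : ℝ} (hζ : f.eval ζ = 0)
    (hF : ∀ t, |t - ζ| ≤ |x - ζ| → |f.derivative.derivative.eval t| ≤ F)
    (hx : 4 * F * |x - ζ| ≤ |f.derivative.eval ζ|) (hd : f.derivative.eval ζ ≠ 0) :
    f.derivative.eval x ≠ 0 ∧
      |x - f.eval x / f.derivative.eval x - ζ| ≤
        2 * F / |f.derivative.eval ζ| * |x - ζ| ^ 2 := by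
  have hd' : 0 < |f.derivative.eval ζ| := abs_pos.mpr hd
  have hmem {t : ℝ} (ht : t ∈ Set.uIcc ζ x) : |t - ζ| ≤ |x - ζ| :=
    Set.abs_sub_left_of_mem_uIcc ht
  have hmem' {t : ℝ} (ht : t ∈ Set.uIcc ζ x) : |t - x| ≤ |x - ζ| := by
    rw [abs_sub_comm t x]
    exact Set.abs_sub_right_of_mem_uIcc ht
  have h1 : |f.derivative.eval x - f.derivative.eval ζ| ≤ F * |x - ζ| :=
    abs_eval_sub_eval_le fun t ht => hF t (hmem ht)
  have hF0 : 0 ≤ F := (abs_nonneg _).trans (hF ζ (by simp))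
  have h2 : |f.derivative.eval ζ| / 2 ≤ |f.derivative.eval x| := by
    have := abs_sub_abs_le_abs_sub (f.derivative.eval ζ) (f.derivative.eval x)
    rw [abs_sub_comm] at this
    nlinarith [mul_nonneg hF0 (abs_nonneg (x - ζ))]
  have hne : f.derivative.eval x ≠ 0 := abs_pos.mp (by linarith)
  refine ⟨hne, ?_⟩
  -- Subtracting the line of slope `f'(x)` leaves a derivative of size at most `F |x - ζ|`; the mean
  -- value bound then gives the square.
  have h3 : |(f - C (f.derivative.eval x) * X).eval x -
      (f - C (f.derivative.eval x) * X).eval ζ| ≤ F * |x - ζ| * |x - ζ| := by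
    refine abs_eval_sub_eval_le fun t ht => ?_
    have h4 : |f.derivative.eval t - f.derivative.eval x| ≤ F * |t - x| := by
      refine abs_eval_sub_eval_le fun u hu => hF u (hmem ?_)
      exact Set.uIcc_subset_uIcc Set.right_mem_uIcc ht hu
    simp only [derivative_sub, derivative_C_mul, derivative_X, eval_sub, eval_C, mul_one]
    exact h4.trans (mul_le_mul_of_nonneg_left (hmem' ht) hF0)
  have h5 : x - f.eval x / f.derivative.eval x - ζ =
      -((f - C (f.derivative.eval x) * X).eval x -
        (f - C (f.derivative.eval x) * X).eval ζ) / f.derivative.eval x := by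
    simp only [eval_sub, eval_mul, eval_C, eval_X, hζ]
    field_simp
    ring
  rw [h5, abs_div, abs_neg, div_le_iff₀ (by linarith)]
  refine h3.trans ?_
  have h6 : 2 * F / |f.derivative.eval ζ| * |x - ζ| ^ 2 * (|f.derivative.eval ζ| / 2) =
      F * |x - ζ| * |x - ζ| := by
    field_simp
  rw [← h6]
  gcongr

lemma isApproximateRoot_of_abs_sub_le {f : ℝ[X]} {ζ z F : ℝ} (hζ : f.eval ζ = 0)
    (hF : ∀ x, |x - ζ| ≤ |z - ζ| → |f.derivative.derivative.eval x| ≤ F)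
    (hz : 4 * F * |z - ζ| ≤ |f.derivative.eval ζ|) (hd : f.derivative.eval ζ ≠ 0) :
    IsApproximateRoot f z ζ := by
  have hd' : 0 < |f.derivative.eval ζ| := abs_pos.mpr hd
  have hF0 : 0 ≤ F := (abs_nonneg _).trans (hF ζ (by simp))
  let N : ℝ → ℝ := fun x => x - f.eval x / f.derivative.eval x
  have hstep (x : ℝ) (hx : |x - ζ| ≤ |z - ζ|) := abs_newton_sub_le hζ
    (fun t ht => hF t (ht.trans hx))
    ((mul_le_mul_of_nonneg_left hx (by positivity)).trans hz) hd
  -- Quadratic error constant times initial error: the factor 1/2 of Smale's definition.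
  have hM : 2 * F / |f.derivative.eval ζ| * |z - ζ| ≤ 1 / 2 := by
    rw [div_mul_eq_mul_div, div_le_iff₀ hd']
    linarith
  have hle (i : ℕ) : (1 / 2 : ℝ) ^ (2 ^ i - 1) * |z - ζ| ≤ |z - ζ| :=
    mul_le_of_le_one_left (abs_nonneg _) (pow_le_one₀ (by norm_num) (by norm_num))
  have hmain (i : ℕ) : |N^[i] z - ζ| ≤ (1 / 2 : ℝ) ^ (2 ^ i - 1) * |z - ζ| := by
    induction i with
    | zero => simp
    | succ i ih =>
      rw [Function.iterate_succ_apply']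
      refine (hstep _ (ih.trans (hle i))).2.trans ?_
      have hexp : 2 ^ (i + 1) - 1 = (2 ^ i - 1) * 2 + 1 := by
        have : 1 ≤ 2 ^ i := Nat.one_le_two_pow
        rw [pow_succ]; omega
      calc _ ≤ 2 * F / |f.derivative.eval ζ| * ((1 / 2 : ℝ) ^ (2 ^ i - 1) * |z - ζ|) ^ 2 := by
            gcongr
        _ = (2 * F / |f.derivative.eval ζ| * |z - ζ|) *
            ((1 / 2 : ℝ) ^ ((2 ^ i - 1) * 2) * |z - ζ|) := by rw [pow_mul]; ring
        _ ≤ 1 / 2 * ((1 / 2 : ℝ) ^ ((2 ^ i - 1) * 2) * |z - ζ|) := by gcongr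
        _ = _ := by rw [hexp, pow_succ]; ring
  refine ⟨hζ, f, Or.inl ⟨hd, rfl⟩, fun i => N^[i] z, rfl, fun i => ⟨?_, ?_, hmain i⟩⟩
  · exact (hstep _ ((hmain i).trans (hle i))).1
  · exact Function.iterate_succ_apply' N i z

/-! ### Newton's method for trinomials -/

lemma eval_realTrinomial (m n : ℕ) (c₁ c₂ c₃ : ℤ) (x : ℝ) :
    (realTrinomial m n c₁ c₂ c₃).eval x = c₁ + c₂ * x ^ m + c₃ * x ^ n := by
  simp [realTrinomial]

lemma eval_derivative_realTrinomial (m n : ℕ) (c₁ c₂ c₃ : ℤ) (x : ℝ) :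
    (realTrinomial m n c₁ c₂ c₃).derivative.eval x =
      c₂ * (m * x ^ (m - 1)) + c₃ * (n * x ^ (n - 1)) := by
  simp [realTrinomial, derivative_X_pow]

lemma eval_derivative_derivative_realTrinomial (m n : ℕ) (c₁ c₂ c₃ : ℤ) (x : ℝ) :
    (realTrinomial m n c₁ c₂ c₃).derivative.derivative.eval x =
      c₂ * (m * (((m - 1 : ℕ) : ℝ) * x ^ (m - 2))) +
        c₃ * (n * (((n - 1 : ℕ) : ℝ) * x ^ (n - 2))) := by
  simp [realTrinomial, derivative_X_pow, Nat.sub_sub]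

lemma mul_derivative_realTrinomial {m n : ℕ} (hm : 0 < m) (hn : 0 < n) (c₁ c₂ c₃ : ℤ) (x : ℝ) :
    x * (realTrinomial m n c₁ c₂ c₃).derivative.eval x =
      m * (c₂ * x ^ m) + n * (c₃ * x ^ n) := by
  rw [eval_derivative_realTrinomial]
  obtain ⟨m, rfl⟩ := Nat.exists_eq_succ_of_ne_zero hm.ne'
  obtain ⟨n, rfl⟩ := Nat.exists_eq_succ_of_ne_zero hn.ne'
  simp only [Nat.succ_eq_add_one, Nat.add_sub_cancel, pow_succ]
  ring

lemma one_add_one_div_pow_le {n j : ℕ} (hn : 0 < n) (hj : j ≤ n) :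
    (1 + 1 / (n : ℝ)) ^ j ≤ 3 := by
  have hn' : (0 : ℝ) < n := by exact_mod_cast hn
  have h1 : 1 ≤ 1 + 1 / (n : ℝ) := by
    have : 0 < 1 / (n : ℝ) := by positivity
    linarith
  calc (1 + 1 / (n : ℝ)) ^ j ≤ (1 + 1 / (n : ℝ)) ^ n := pow_le_pow_right₀ h1 hj
    _ ≤ (Real.exp (1 / n)) ^ n := by
        gcongr
        rw [add_comm]
        exact Real.add_one_le_exp _
    _ = Real.exp 1 := by rw [← Real.exp_nat_mul]; congr 1; field_simp
    _ ≤ 3 := by have := Real.exp_one_lt_d9; linarith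

/-- A relative perturbation of size `1 / n` changes powers of exponent at most `n` by a factor at
most `e < 3`. -/
lemma abs_second_derivative_pow_le {n j : ℕ} (hn : 0 < n) (hj : j ≤ n) {x ζ : ℝ} (hζ : 0 < ζ)
    (hx : |x - ζ| ≤ ζ / n) :
    |(j : ℝ) * (((j - 1 : ℕ) : ℝ) * x ^ (j - 2))| ≤ 3 * n ^ 2 * (ζ ^ j / ζ ^ 2) := by
  have hx' : |x| ≤ ζ * (1 + 1 / n) := by
    have := abs_sub_abs_le_abs_sub x ζ
    rw [abs_of_pos hζ] at this
    have h2 : ζ * (1 + 1 / (n : ℝ)) = ζ + ζ / n := by ring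
    linarith
  -- For `j < 2` the exponent `j - 2` truncates to 0, harmlessly, as the coefficient vanishes.
  rcases Nat.lt_or_ge j 2 with h | h
  · have : (j : ℝ) * (((j - 1 : ℕ) : ℝ) * x ^ (j - 2)) = 0 := by
      interval_cases j <;> simp
    rw [this, abs_zero]
    positivity
  · have hj' : (j : ℝ) ≤ n := by exact_mod_cast hj
    have hj'' : ((j - 1 : ℕ) : ℝ) ≤ n := by exact_mod_cast (Nat.sub_le j 1).trans hj
    have hz : ζ ^ j / ζ ^ 2 = ζ ^ (j - 2) := by
      rw [div_eq_iff (by positivity), ← pow_add, Nat.sub_add_cancel h]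
    rw [hz, abs_mul, abs_mul, abs_pow, Nat.abs_cast, Nat.abs_cast]
    calc _ ≤ (n : ℝ) * (n * (ζ * (1 + 1 / n)) ^ (j - 2)) := by gcongr
      _ = n ^ 2 * (ζ ^ (j - 2) * (1 + 1 / n) ^ (j - 2)) := by rw [mul_pow]; ring
      _ ≤ n ^ 2 * (ζ ^ (j - 2) * 3) := by
          gcongr
          exact one_add_one_div_pow_le hn ((Nat.sub_le j 2).trans hj)
      _ = _ := by ring

/-- `D` acts as a condition number: it bounds the sum of the sizes of the nonconstant terms relative
to `|ζ f'(ζ)|`. That same sum controls `f''` near `ζ`. -/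
lemma isApproximateRoot_realTrinomial {m n : ℕ} (hm : 0 < m) (hmn : m < n) {c₁ c₂ c₃ : ℤ}
    (hc₃ : 0 < c₃) {ζ z ε D : ℝ} (hζ : 0 < ζ) (hD : 0 < D)
    (hroot : (realTrinomial m n c₁ c₂ c₃).eval ζ = 0)
    (hder : |(c₂ : ℝ)| * ζ ^ m + c₃ * ζ ^ n ≤ D * |m * (c₂ * ζ ^ m) + n * (c₃ * ζ ^ n)|)
    (hz : |z - ζ| ≤ ε * ζ) (hε : ε ≤ 1 / n) (hε' : 12 * n ^ 2 * D * ε ≤ 1) :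
    IsApproximateRoot (realTrinomial m n c₁ c₂ c₃) z ζ := by
  have hn : 0 < n := by omega
  have hc₃' : (0 : ℝ) < c₃ := by exact_mod_cast hc₃
  have hE := mul_derivative_realTrinomial hm hn c₁ c₂ c₃ ζ
  set f := realTrinomial m n c₁ c₂ c₃
  set A := |(c₂ : ℝ)| * ζ ^ m + c₃ * ζ ^ n with hA
  have hA0 : 0 < A := by positivity
  rw [← hE, abs_mul, abs_of_pos hζ] at hder
  have hd : f.derivative.eval ζ ≠ 0 := by
    intro h
    rw [h] at hder
    simp at hder
    linarith
  have hzn : |z - ζ| ≤ ζ / n := hz.trans (by rw [div_eq_mul_one_div, mul_comm]; gcongr)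
  refine isApproximateRoot_of_abs_sub_le (F := 3 * n ^ 2 * (A / ζ ^ 2)) hroot ?_ ?_ hd
  · intro x hx
    have hxn := hx.trans hzn
    rw [eval_derivative_derivative_realTrinomial]
    refine (abs_add_le _ _).trans ?_
    rw [abs_mul (c₂ : ℝ), abs_mul (c₃ : ℝ), abs_of_pos hc₃']
    calc _ ≤ |(c₂ : ℝ)| * (3 * n ^ 2 * (ζ ^ m / ζ ^ 2)) + c₃ * (3 * n ^ 2 * (ζ ^ n / ζ ^ 2)) := by
          gcongr
          · exact abs_second_derivative_pow_le hn hmn.le hζ hxn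
          · exact abs_second_derivative_pow_le hn le_rfl hζ hxn
      _ = _ := by rw [hA]; ring
  · have hε0 : 0 ≤ ε := by
      by_contra! h
      nlinarith [abs_nonneg (z - ζ)]
    calc 4 * (3 * n ^ 2 * (A / ζ ^ 2)) * |z - ζ|
        ≤ 4 * (3 * n ^ 2 * (D * (ζ * |f.derivative.eval ζ|) / ζ ^ 2)) * (ε * ζ) := by
          gcongr
      _ = 12 * n ^ 2 * D * ε * |f.derivative.eval ζ| := by field_simp; ring
      _ ≤ 1 * |f.derivative.eval ζ| := by gcongr
      _ = _ := one_mul _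

/-! ### The critical constant and separation from the discriminant -/

section RConst

variable {m n : ℕ}

/-- This form shows the constant as the value of `(1 + u) / u ^ (m / n)` at its minimiser `u = m /
(n - m)`. -/
lemma rConst_eq (hm : 0 < m) (hmn : m < n) :
    rConst m n = (1 + (m : ℝ) / ((n : ℝ) - m)) / ((m : ℝ) / ((n : ℝ) - m)) ^ ((m : ℝ) / n) := by
  have hm' : (0 : ℝ) < m := by exact_mod_cast hm
  have hd : (0 : ℝ) < (n : ℝ) - m := by
    have : (m : ℝ) < n := by exact_mod_cast hmn
    linarith
  have hn' : (0 : ℝ) < n := by linarith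
  have h1 : ((n : ℝ) - m) / n = 1 - (m : ℝ) / n := by field_simp
  have h2 : ((m : ℝ)) ^ ((m : ℝ) / n) ≠ 0 := by positivity
  have h3 : ((n : ℝ) - m) ^ ((m : ℝ) / n) ≠ 0 := by positivity
  rw [rConst, h1, Real.rpow_sub hd, Real.rpow_one, Real.div_rpow hm'.le hd.le]
  field_simp
  ring

lemma rConst_pos (hm : 0 < m) (hmn : m < n) : 0 < rConst m n := by
  have hm' : (0 : ℝ) < m := by exact_mod_cast hm
  have hd : (0 : ℝ) < (n : ℝ) - m := by
    have : (m : ℝ) < n := by exact_mod_cast hmn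
    linarith
  rw [rConst_eq hm hmn]
  positivity

lemma rConst_symm (hmn : m < n) : rConst (n - m) n = rConst m n := by
  rw [rConst, rConst, Nat.cast_sub hmn.le, sub_sub_cancel, mul_comm]

/-- Identifies the growth rate of the coefficients for `α = n / m`. -/
lemma rConst_rpow (hm : 0 < m) (hmn : m < n) :
    rConst m n ^ ((n : ℝ) / m) =
      ((n : ℝ) / m - 1) * ((n : ℝ) / m / ((n : ℝ) / m - 1)) ^ ((n : ℝ) / m) := by
  have hm' : (0 : ℝ) < m := by exact_mod_cast hm
  have hd : (0 : ℝ) < (n : ℝ) - m := by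
    have : (m : ℝ) < n := by exact_mod_cast hmn
    linarith
  have hn' : (0 : ℝ) < n := by linarith
  have h1 : (n : ℝ) / m - 1 = ((n : ℝ) - m) / m := by field_simp
  have h2 : (n : ℝ) / m / (((n : ℝ) - m) / m) = 1 + m / ((n : ℝ) - m) := by
    field_simp; ring
  have h3 : (m : ℝ) / n * (n / m) = 1 := by field_simp
  rw [h1, h2, rConst_eq hm hmn, Real.div_rpow (by positivity) (by positivity), ← Real.rpow_mul
    (by positivity), h3, Real.rpow_one]
  field_simp

lemma inv_rConst (hm : 0 < m) (hmn : m < n) :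
    (rConst m n)⁻¹ = ((m : ℝ) / n) ^ ((m : ℝ) / n) * (1 - (m : ℝ) / n) ^ (1 - (m : ℝ) / n) := by
  have hm' : (0 : ℝ) < m := by exact_mod_cast hm
  have hd : (0 : ℝ) < (n : ℝ) - m := by
    have : (m : ℝ) < n := by exact_mod_cast hmn
    linarith
  have hn' : (0 : ℝ) < n := by linarith
  have h1 : 1 - (m : ℝ) / n = ((n : ℝ) - m) / n := by field_simp
  have h2 : (n : ℝ) ^ ((m : ℝ) / n) * (n : ℝ) ^ (((n : ℝ) - m) / n) = n := by
    rw [← Real.rpow_add hn', ← h1, add_sub_cancel, Real.rpow_one]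
  rw [rConst, h1, Real.div_rpow hm'.le hn'.le, Real.div_rpow hd.le hn'.le, div_mul_div_comm, h2,
    inv_div]

/-- If `u` and `m / (n - m)` differ, then so do `(1 + u) / u ^ (m / n)` and its minimal
value `rConst m n`, but by no larger factor. -/
lemma le_rConst_mul_max (hm : 0 < m) (hmn : m < n) {c u : ℝ} (hu : 0 < u)
    (h : 1 + u = c * u ^ ((m : ℝ) / n)) :
    ((m : ℝ) / ((n : ℝ) - m) ≤ u ∧ c * (m / ((n : ℝ) - m)) ≤ rConst m n * u) ∨
      (u ≤ (m : ℝ) / ((n : ℝ) - m) ∧ c * u ≤ rConst m n * (m / ((n : ℝ) - m))) := by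
  have hm' : (0 : ℝ) < m := by exact_mod_cast hm
  have hmn' : (m : ℝ) < n := by exact_mod_cast hmn
  have hd : (0 : ℝ) < (n : ℝ) - m := by linarith
  have hn' : (0 : ℝ) < n := by linarith
  rw [rConst_eq hm hmn]
  set u₀ := (m : ℝ) / ((n : ℝ) - m)
  have hu₀ : 0 < u₀ := by positivity
  set μ := (m : ℝ) / n
  have hμ0 : 0 ≤ μ := by positivity
  have hμ1 : μ ≤ 1 := by rw [div_le_one hn']; exact hmn'.le
  have hc : c = (1 + u) / u ^ μ := by rw [h]; field_simp
  rcases le_total u₀ u with hle | hle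
  · refine Or.inl ⟨hle, ?_⟩
    rw [hc, div_mul_eq_mul_div, div_mul_eq_mul_div]
    gcongr ?_ / ?_
    · nlinarith
    · gcongr
  · refine Or.inr ⟨hle, ?_⟩
    have h1 : u₀ ^ μ / u ^ μ ≤ u₀ / u := by
      rw [← Real.div_rpow hu₀.le hu.le]
      refine (Real.rpow_le_rpow_of_exponent_le ?_ hμ1).trans_eq (Real.rpow_one _)
      rwa [le_div_iff₀ hu, one_mul]
    rw [div_le_div_iff₀ (by positivity) hu] at h1
    rw [hc, div_mul_eq_mul_div, div_mul_eq_mul_div, div_le_div_iff₀ (by positivity) (by positivity)]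
    calc (1 + u) * u * u₀ ^ μ = (1 + u) * (u₀ ^ μ * u) := by ring
      _ ≤ (1 + u₀) * (u₀ * u ^ μ) := by gcongr
      _ = _ := by ring

/-- The logarithmic derivative of `1 - c y ^ m + y ^ n` at a root is bounded below when `c` is
bounded away from `rConst m n`. -/
lemma add_le_mul_abs_sub (hm : 0 < m) (hmn : m < n) {c y Λ : ℝ} (hy : 0 < y)
    (h : 1 - c * y ^ m + y ^ n = 0) (hΛ : 0 < Λ) (hc : rConst m n * (Λ + 1) ≤ c * Λ) :
    c * y ^ m + y ^ n ≤ 3 * n * (Λ + 1) * |n * y ^ n - m * (c * y ^ m)| := by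
  have hm' : (1 : ℝ) ≤ m := by exact_mod_cast hm
  have hmn' : (m : ℝ) + 1 ≤ n := by exact_mod_cast hmn
  have hd : (0 : ℝ) < (n : ℝ) - m := by linarith
  have hn' : (0 : ℝ) < n := by linarith
  have hr := rConst_pos hm hmn
  set u := y ^ n with hu_def
  have hu : 0 < u := by positivity
  have hcy : c * y ^ m = 1 + u := by linarith
  have hpow : u ^ ((m : ℝ) / n) = y ^ m := by
    rw [hu_def, ← Real.rpow_natCast_mul hy.le, mul_div_cancel₀ _ hn'.ne', Real.rpow_natCast]
  rw [hcy]
  have hkey := le_rConst_mul_max hm hmn hu (by rw [hpow, hcy])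
  set r := rConst m n
  set u₀ := (m : ℝ) / ((n : ℝ) - m) with hu₀_def
  have hu₀ : 0 < u₀ := by positivity
  have hmu₀ : (m : ℝ) = (n - m) * u₀ := by rw [hu₀_def]; field_simp
  -- In both cases `c / r ≥ 1 + 1 / Λ` passes to the ratio of `u` and `u₀`, and the derivative
  -- expression is `(n - m) (u - u₀)`.
  rcases hkey with ⟨hle, hcu⟩ | ⟨hle, hcu⟩
  · have h1 : (Λ + 1) * u₀ ≤ Λ * u := by
      refine le_of_mul_le_mul_left ?_ hr
      nlinarith [mul_le_mul_of_nonneg_right hc hu₀.le, mul_le_mul_of_nonneg_left hcu hΛ.le]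
    have h2 : u ≤ (Λ + 1) * (u - u₀) := by linarith
    have h3 : (n : ℝ) * u - m * (1 + u) = (n - m) * (u - u₀) := by
      rw [mul_sub, ← hmu₀]; ring
    have h4 : 1 ≤ ((n : ℝ) - m) * u := by nlinarith
    rw [h3, abs_of_nonneg (mul_nonneg hd.le (by linarith))]
    have h5 : ((n : ℝ) - m) * u ≤ (Λ + 1) * ((n - m) * (u - u₀)) := by nlinarith
    have h6 : u ≤ ((n : ℝ) - m) * u := by nlinarith
    calc 1 + u + u ≤ 3 * (((n : ℝ) - m) * u) := by linarith
      _ ≤ 3 * n * (((n : ℝ) - m) * u) := by nlinarith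
      _ ≤ 3 * n * ((Λ + 1) * ((n - m) * (u - u₀))) := by gcongr
      _ = _ := by ring
  · have h1 : (Λ + 1) * u ≤ Λ * u₀ := by
      refine le_of_mul_le_mul_left ?_ hr
      nlinarith [mul_le_mul_of_nonneg_right hc hu.le, mul_le_mul_of_nonneg_left hcu hΛ.le]
    have h2 : u₀ ≤ (Λ + 1) * (u₀ - u) := by linarith
    have h3 : (n : ℝ) * u - m * (1 + u) = -((n - m) * (u₀ - u)) := by
      rw [mul_sub, ← hmu₀]; ring
    have h4 : (m : ℝ) ≤ (Λ + 1) * ((n - m) * (u₀ - u)) := by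
      nlinarith [mul_le_mul_of_nonneg_left h2 hd.le]
    have h5 : u₀ ≤ m := by
      rw [hu₀_def]; exact div_le_self (by linarith) (by linarith)
    rw [h3, abs_neg, abs_of_nonneg (mul_nonneg hd.le (by linarith))]
    calc 1 + u + u ≤ 3 * n * 1 := by linarith
      _ ≤ 3 * n * m := by gcongr
      _ ≤ 3 * n * ((Λ + 1) * ((n - m) * (u₀ - u))) := by gcongr
      _ = _ := by ring

end RConst

/-! ### The three series as Fuss-Catalan series -/

section Terms

variable {m n : ℕ} {c : ℝ}

lemma prod_Ico_one_succ (g : ℕ → ℝ) (k : ℕ) :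
    ∏ j ∈ Finset.Ico 1 (k + 1), g j = ∏ j ∈ Finset.range k, g (j + 1) := by
  rw [Finset.prod_Ico_eq_prod_range, Nat.add_sub_cancel]
  exact Finset.prod_congr rfl fun j _ => by rw [add_comm]

lemma one_div_mul_prod_eq {d : ℝ} (hd : d ≠ 0) (g : ℕ → ℝ) (k : ℕ) :
    1 / ((((k + 1 : ℕ) : ℝ)) * d ^ (k + 1)) *
      ∏ j ∈ Finset.range k, d * g j / ((j + 1 : ℕ) : ℝ) =
      1 / d / ((k + 1).factorial : ℝ) * ∏ j ∈ Finset.range k, g j := by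
  have h : ∏ j ∈ Finset.range k, ((j + 1 : ℕ) : ℝ) = k.factorial := by
    exact_mod_cast Finset.prod_range_add_one_eq_factorial k
  rw [Finset.prod_div_distrib, Finset.prod_mul_distrib, Finset.prod_const, Finset.card_range, h,
    Nat.factorial_succ, Nat.cast_mul, pow_succ]
  have : ((k + 1 : ℕ) : ℝ) ≠ 0 := by positivity
  field_simp

lemma lowTerm_succ (hm : 0 < m) (k : ℕ) :
    lowTerm m n c (k + 1) =
      fussCatalan (n / m) (1 / m) (k + 1) * (1 / c ^ ((n : ℝ) / m)) ^ (k + 1) := by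
  have hm' : (m : ℝ) ≠ 0 := by positivity
  rw [lowTerm, fussCatalan_succ, prod_Ico_one_succ, ← one_div_mul_prod_eq hm']
  congr 2
  refine Finset.prod_congr rfl fun j _ => ?_
  congr 1
  push_cast
  field_simp

lemma midTerm_succ (hn : 0 < n) (k : ℕ) :
    midTerm m n c (k + 1) = fussCatalan (m / n) (1 / n) (k + 1) * c ^ (k + 1) := by
  have hn' : (n : ℝ) ≠ 0 := by positivity
  rw [midTerm, fussCatalan_succ, prod_Ico_one_succ, ← one_div_mul_prod_eq hn']
  congr 2
  refine Finset.prod_congr rfl fun j _ => ?_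
  congr 1
  push_cast
  field_simp

lemma hiTerm_succ (hmn : m < n) (k : ℕ) :
    hiTerm m n c (k + 1) =
      -(fussCatalan (n / (n - m : ℕ)) (-(1 / (n - m : ℕ))) (k + 1) *
        (1 / c ^ ((n : ℝ) / (n - m : ℕ))) ^ (k + 1)) := by
  rw [Nat.cast_sub hmn.le]
  have hd : (n : ℝ) - m ≠ 0 := by
    have : (m : ℝ) < n := by exact_mod_cast hmn
    linarith
  rw [hiTerm, fussCatalan_succ, neg_div, neg_mul, neg_mul, neg_neg, prod_Ico_one_succ,
    ← one_div_mul_prod_eq hd, Finset.prod_div_distrib, Finset.prod_div_distrib]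
  congr 3
  -- The factors of the two products agree in reverse order.
  rw [← Finset.prod_range_reflect]
  refine Finset.prod_congr rfl fun j hj => ?_
  have hj' := Finset.mem_range.mp hj
  have h1 : ((k - 1 - j + 1 : ℕ) : ℝ) = k - j := by
    rw [← Nat.cast_sub hj'.le]
    congr 1
    omega
  rw [h1]
  push_cast
  field_simp
  ring

lemma abs_fussCatalan_mul_pow_le_of_rConst_le (hm : 0 < m) (hmn : m < n)
    (h : rConst m n ≤ c) {β : ℝ} (hβ : |β| ≤ 1 / m) (k : ℕ) :
    |fussCatalan (n / m) β (k + 1) * (1 / c ^ ((n : ℝ) / m)) ^ (k + 1)| ≤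
      n * (rConst m n / c) ^ (k + 1) := by
  have hm' : (1 : ℝ) ≤ m := by exact_mod_cast hm
  have hmn' : (m : ℝ) + 1 ≤ n := by exact_mod_cast hmn
  have hm0 : (0 : ℝ) < m := by linarith
  have hn0 : (0 : ℝ) < n := by linarith
  have hd : (0 : ℝ) < (n : ℝ) - m := by linarith
  have hr := rConst_pos hm hmn
  have hc : 0 < c := hr.trans_le h
  have hα : 1 < (n : ℝ) / m := by rw [lt_div_iff₀ hm0]; linarith
  have h1m : 1 / (m : ℝ) ≤ 1 := by rw [div_le_one hm0]; exact hm'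
  have hβ' : 1 - (n : ℝ) / m ≤ β := by
    have : 1 / (m : ℝ) ≤ n / m - 1 := by
      rw [div_sub_one hm0.ne']; gcongr; linarith
    linarith [neg_abs_le β]
  have hb := abs_fussCatalan_le_of_one_lt hα hβ' (hβ.trans h1m) k
  rw [← rConst_rpow hm hmn] at hb
  rw [abs_mul, abs_of_nonneg (by positivity : 0 ≤ (1 / c ^ ((n : ℝ) / m)) ^ (k + 1))]
  have h2 : 1 / ((n : ℝ) / m - 1) ≤ n := by
    rw [div_sub_one hm0.ne', one_div_div, div_le_iff₀ hd]
    nlinarith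
  -- The true ratio `(r / c) ^ (n / m)` is weakened to `r / c`, which does not change under `m ↦ n -
  -- m` and so serves both `xLow` and `xHi`.
  have h3 : rConst m n ^ ((n : ℝ) / m) * (1 / c ^ ((n : ℝ) / m)) ≤ rConst m n / c := by
    rw [mul_one_div, ← Real.div_rpow hr.le hc.le]
    refine (Real.rpow_le_rpow_of_exponent_ge (by positivity) ?_ hα.le).trans_eq (Real.rpow_one _)
    rwa [div_le_one hc]
  calc _ ≤ (1 / ((n : ℝ) / m - 1) * (rConst m n ^ ((n : ℝ) / m)) ^ (k + 1)) *
        (1 / c ^ ((n : ℝ) / m)) ^ (k + 1) := by gcongr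
    _ = 1 / ((n : ℝ) / m - 1) *
        (rConst m n ^ ((n : ℝ) / m) * (1 / c ^ ((n : ℝ) / m))) ^ (k + 1) := by
        rw [mul_pow, mul_assoc]
    _ ≤ _ := by gcongr

lemma abs_fussCatalan_mul_pow_le (hm : 0 < m) (hmn : m < n) (hc : 0 ≤ c) (k : ℕ) :
    |fussCatalan (m / n) (1 / n) (k + 1) * c ^ (k + 1)| ≤
      n * (c / rConst m n) ^ (k + 1) := by
  have hb := abs_fussCatalan_le_of_lt hm hmn k
  rw [← inv_rConst hm hmn] at hb
  rw [abs_mul, abs_of_nonneg (by positivity : 0 ≤ c ^ (k + 1)), div_eq_inv_mul c, mul_pow,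
    ← mul_assoc]
  gcongr

end Terms

/-! ### Normalising the trinomial -/

section Scaling

variable {m n : ℕ} {c₁ c₂ c₃ : ℤ}

lemma rootScale_pos (hc₁ : c₁ ≠ 0) (hc₃ : 0 < c₃) : 0 < rootScale n c₁ c₃ := by
  have h3 : (c₃ : ℝ) ≠ 0 := by exact_mod_cast hc₃.ne'
  have h1 : (c₁ : ℝ) ≠ 0 := by exact_mod_cast hc₁
  unfold rootScale
  positivity

lemma mul_rootScale_pow (hn : 0 < n) (hc₃ : 0 < c₃) :
    (c₃ : ℝ) * rootScale n c₁ c₃ ^ n = |(c₁ : ℝ)| := by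
  have h3 : (0 : ℝ) < c₃ := by exact_mod_cast hc₃
  have hn' : (n : ℝ) ≠ 0 := by positivity
  rw [rootScale, ← Real.rpow_mul_natCast (abs_nonneg _), one_div_mul_cancel hn', Real.rpow_one,
    abs_div, abs_of_pos h3]
  field_simp

lemma abs_mul_rootScale_pow (hn : 0 < n) (hc₁ : c₁ ≠ 0) (hc₃ : 0 < c₃) :
    |(c₂ : ℝ)| * rootScale n c₁ c₃ ^ m = |(c₁ : ℝ)| * normCoeff m n c₁ c₂ c₃ := by
  have h3 : (0 : ℝ) < c₃ := by exact_mod_cast hc₃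
  have h1 : 0 < |(c₁ : ℝ)| := abs_pos.mpr (by exact_mod_cast hc₁)
  have hn' : (n : ℝ) ≠ 0 := by positivity
  have h4 : ((n : ℝ) - m) / n = 1 - m / n := by field_simp
  rw [rootScale, normCoeff, ← Real.rpow_mul_natCast (abs_nonneg _), abs_div, abs_of_pos h3,
    one_div_mul_eq_div, Real.div_rpow h1.le h3.le, h4, Real.rpow_sub h1, Real.rpow_one]
  field_simp

lemma illConditioned_expr_eq (hm : 0 < m) (hmn : m < n) :
    |(c₂ : ℝ) / n| * |((n : ℝ) - m) / c₁| ^ (((n : ℝ) - m) / n) *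
      |(m : ℝ) / c₃| ^ ((m : ℝ) / n) = normCoeff m n c₁ c₂ c₃ / rConst m n := by
  have hm' : (0 : ℝ) < m := by exact_mod_cast hm
  have hd : (0 : ℝ) < (n : ℝ) - m := by
    have : (m : ℝ) < n := by exact_mod_cast hmn
    linarith
  rw [normCoeff, rConst, abs_div, abs_div, abs_div, Nat.abs_cast, Nat.abs_cast, abs_of_pos hd,
    Real.div_rpow hd.le (abs_nonneg _), Real.div_rpow hm'.le (abs_nonneg _)]
  field_simp

/-- A trinomial with a degenerate root lies on the discriminant variety. -/
lemma normCoeff_eq_rConst_of_isDegenerateRoot (hm : 0 < m) (hmn : m < n) (hc₁ : c₁ ≠ 0)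
    (hc₃ : 0 < c₃) {ζ : ℝ} (h : IsDegenerateRoot (realTrinomial m n c₁ c₂ c₃) ζ) :
    normCoeff m n c₁ c₂ c₃ = rConst m n := by
  have hn : 0 < n := by omega
  have hm' : (0 : ℝ) < m := by exact_mod_cast hm
  have hd : (0 : ℝ) < (n : ℝ) - m := by
    have : (m : ℝ) < n := by exact_mod_cast hmn
    linarith
  have hn' : (0 : ℝ) < n := by linarith
  have h3 : (0 : ℝ) < c₃ := by exact_mod_cast hc₃
  have h1 : 0 < |(c₁ : ℝ)| := abs_pos.mpr (by exact_mod_cast hc₁)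
  obtain ⟨hf, hf'⟩ := h
  have hd0 := mul_derivative_realTrinomial hm hn c₁ c₂ c₃ ζ
  rw [hf', mul_zero] at hd0
  rw [eval_realTrinomial] at hf
  have e3 : (c₃ : ℝ) * ζ ^ n = m / (n - m) * c₁ := by
    field_simp
    linear_combination (-(m : ℝ)) * hf - hd0
  have e2 : (c₂ : ℝ) * ζ ^ m = -(1 + m / (n - m)) * c₁ := by
    linear_combination hf - e3
  have a3 := congrArg abs e3
  have a2 := congrArg abs e2
  set u₀ := (m : ℝ) / (n - m) with hu₀
  have hu₀pos : 0 < u₀ := by positivity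
  rw [abs_mul, abs_mul, abs_pow, abs_of_pos h3, abs_of_pos hu₀pos] at a3
  rw [abs_mul, abs_mul, abs_pow, abs_neg, abs_of_pos (by linarith : 0 < 1 + u₀)] at a2
  have hs := rootScale_pos (n := n) hc₁ hc₃
  have s3 := mul_rootScale_pow (c₁ := c₁) hn hc₃
  have s2 := abs_mul_rootScale_pow (m := m) (c₂ := c₂) hn hc₁ hc₃
  set s := rootScale n c₁ c₃
  set c := normCoeff m n c₁ c₂ c₃
  have ht : (|ζ| / s) ^ n = u₀ := by
    rw [div_pow, div_eq_iff (by positivity)]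
    refine mul_left_cancel₀ h3.ne' ?_
    rw [a3, ← s3]
    ring
  have ht' : c * (|ζ| / s) ^ m = 1 + u₀ := by
    refine mul_left_cancel₀ h1.ne' ?_
    rw [← mul_assoc, ← s2, div_pow, mul_comm _ (1 + u₀), ← a2]
    field_simp
  have hpow : u₀ ^ ((m : ℝ) / n) = (|ζ| / s) ^ m := by
    rw [← ht, ← Real.rpow_natCast_mul (by positivity), mul_div_cancel₀ _ hn'.ne',
      Real.rpow_natCast]
  rw [rConst_eq hm hmn, ← hu₀, eq_div_iff (by positivity), hpow, ht']

lemma isApproximateRoot_rootScale_mul (hm : 0 < m) (hmn : m < n) (hc₁ : c₁ ≠ 0) (hc₂ : c₂ < 0)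
    (hc₃ : 0 < c₃) {σ y y' ε D : ℝ} (hσ : (c₁ : ℝ) = |(c₁ : ℝ)| * σ) (hy : 0 < y) (hD : 0 < D)
    (hroot : σ - normCoeff m n c₁ c₂ c₃ * y ^ m + y ^ n = 0)
    (hder : normCoeff m n c₁ c₂ c₃ * y ^ m + y ^ n ≤
      D * |n * y ^ n - m * (normCoeff m n c₁ c₂ c₃ * y ^ m)|)
    (hy' : |y - y'| ≤ ε * y) (hε : ε ≤ 1 / n) (hε' : 12 * n ^ 2 * D * ε ≤ 1) :
    IsApproximateRoot (realTrinomial m n c₁ c₂ c₃) (rootScale n c₁ c₃ * y')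
      (rootScale n c₁ c₃ * y) := by
  have hn : 0 < n := by omega
  have h1 : 0 < |(c₁ : ℝ)| := abs_pos.mpr (by exact_mod_cast hc₁)
  have h2 : |(c₂ : ℝ)| = -c₂ := abs_of_neg (by exact_mod_cast hc₂)
  have hs := rootScale_pos (n := n) hc₁ hc₃
  have s3 := mul_rootScale_pow (c₁ := c₁) hn hc₃
  have s2 := abs_mul_rootScale_pow (m := m) (c₂ := c₂) hn hc₁ hc₃
  set s := rootScale n c₁ c₃
  set c := normCoeff m n c₁ c₂ c₃
  have e3 : (c₃ : ℝ) * (s * y) ^ n = |(c₁ : ℝ)| * y ^ n := by rw [← s3]; ring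
  have e2 : |(c₂ : ℝ)| * (s * y) ^ m = |(c₁ : ℝ)| * (c * y ^ m) := by
    rw [← mul_assoc, ← s2]; ring
  have e2' : (c₂ : ℝ) * (s * y) ^ m = -(|(c₁ : ℝ)| * (c * y ^ m)) := by
    rw [← e2, h2]; ring
  refine isApproximateRoot_realTrinomial hm hmn hc₃ (mul_pos hs hy) hD ?_ ?_ ?_ hε hε'
  · rw [eval_realTrinomial, e2', e3]
    linear_combination hσ + |(c₁ : ℝ)| * hroot
  · have e4 : (m : ℝ) * (c₂ * (s * y) ^ m) + n * (c₃ * (s * y) ^ n) =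
        |(c₁ : ℝ)| * (n * y ^ n - m * (c * y ^ m)) := by rw [e2', e3]; ring
    rw [e4, e2, e3, abs_mul, abs_abs]
    nlinarith [mul_le_mul_of_nonneg_left hder h1.le]
  · rw [← mul_sub, abs_mul, abs_of_pos hs, abs_sub_comm]
    nlinarith [mul_le_mul_of_nonneg_left hy' hs.le]

end Scaling

/-! ### How many terms suffice -/

section Truncation

variable {Q ρ : ℝ}

lemma two_thirds_le_log (hQ : 2 ≤ Q) : 2 / 3 ≤ Real.log Q := by
  have := Real.log_two_gt_d9
  have := Real.log_le_log (by norm_num) hQ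
  linarith

/-- With `Λ = log Q`, `ρ ≤ 1 - 1 / (Λ + 1) ≤ exp (-1 / (Λ + 1))`, so `l ≥ 16 Λ (Λ + 1)` suffices.
Since `Λ ≥ 2/3`, this is at most `40 Λ ^ 2`. -/
lemma pow_mul_pow_le_one (hQ : 2 ≤ Q) (h0 : 0 ≤ ρ) (hρ : ρ * (Real.log Q + 1) ≤ Real.log Q)
    {l : ℕ} (hl : 40 * Real.log Q ^ 2 ≤ l) : ρ ^ l * Q ^ 16 ≤ 1 := by
  have hL := two_thirds_le_log hQ
  set Λ := Real.log Q with hΛ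
  have hQe : Q = Real.exp Λ := (Real.exp_log (by linarith)).symm
  have h1 : ρ ≤ Real.exp (-(1 / (Λ + 1))) := by
    refine le_trans ?_ (Real.add_one_le_exp _)
    have : ρ ≤ Λ / (Λ + 1) := (le_div_iff₀ (by linarith)).mpr hρ
    refine this.trans (le_of_eq ?_)
    field_simp
    ring
  have h2 : 16 * Λ ≤ l * (1 / (Λ + 1)) := by
    rw [mul_one_div, le_div_iff₀ (by linarith)]
    nlinarith
  calc ρ ^ l * Q ^ 16 ≤ Real.exp (-(1 / (Λ + 1))) ^ l * Q ^ 16 := by gcongr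
    _ = Real.exp (l * -(1 / (Λ + 1)) + 16 * Λ) := by
        rw [hQe, ← Real.exp_nat_mul, ← Real.exp_nat_mul, ← Real.exp_add]
        norm_num
    _ ≤ 1 := by
        rw [Real.exp_le_one_iff]
        linarith

/-- The truncation error is negligible relative to a sum that is not too small. -/
lemma geometric_error_le {C S : ℝ} (hQ : 2 ≤ Q) (hCQ : C ≤ Q) (h0 : 0 ≤ ρ)
    (hρ : ρ * (Real.log Q + 1) ≤ Real.log Q) {l : ℕ} (hl : 40 * Real.log Q ^ 2 ≤ l)
    (hS : 1 ≤ (1 + Q ^ 2) * S) :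
    C * ρ ^ l / (1 - ρ) ≤ 1 / (36 * Q ^ 4) * S := by
  have hL := two_thirds_le_log hQ
  have hpow := pow_mul_pow_le_one hQ h0 hρ hl
  have hLQ : Real.log Q ≤ Q - 1 := Real.log_le_sub_one_of_pos (by linarith)
  set Λ := Real.log Q
  -- Indeed `1 / (1 - ρ) ≤ log Q + 1 ≤ Q`.
  have h1 : 1 ≤ Q * (1 - ρ) := by nlinarith
  have hρ1 : 0 < 1 - ρ := by nlinarith
  have hS0 : 0 < S := by nlinarith
  have hQ8 : (256 : ℝ) ≤ Q ^ 8 := by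
    calc (256 : ℝ) = 2 ^ 8 := by norm_num
      _ ≤ Q ^ 8 := by gcongr
  have hQ2 : 1 ≤ Q ^ 2 := by nlinarith
  have hbig : 36 * Q ^ 6 * (1 + Q ^ 2) ≤ Q ^ 16 := by
    calc 36 * Q ^ 6 * (1 + Q ^ 2) ≤ 36 * Q ^ 6 * (Q ^ 2 + Q ^ 2) := by gcongr
      _ = 72 * Q ^ 8 := by ring
      _ ≤ Q ^ 8 * Q ^ 8 := by gcongr; linarith
      _ = Q ^ 16 := by ring
  have h2 : C * ρ ^ l / (1 - ρ) ≤ Q ^ 2 * ρ ^ l := by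
    rw [div_le_iff₀ hρ1]
    calc C * ρ ^ l ≤ Q * ρ ^ l * 1 := by rw [mul_one]; gcongr
      _ ≤ Q * ρ ^ l * (Q * (1 - ρ)) := by gcongr
      _ = _ := by ring
  refine h2.trans ?_
  rw [one_div_mul_eq_div, le_div_iff₀ (by positivity)]
  calc Q ^ 2 * ρ ^ l * (36 * Q ^ 4) ≤ Q ^ 2 * ρ ^ l * (36 * Q ^ 4) * ((1 + Q ^ 2) * S) :=
        le_mul_of_one_le_right (by positivity) hS
    _ = ρ ^ l * (36 * Q ^ 6 * (1 + Q ^ 2)) * S := by ring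
    _ ≤ ρ ^ l * Q ^ 16 * S := by gcongr
    _ ≤ 1 * S := by gcongr
    _ = S := one_mul S

lemma lt_one_of_mul_log_le (hQ : 2 ≤ Q) (hρ : ρ * (Real.log Q + 1) ≤ Real.log Q) : ρ < 1 := by
  have hL := two_thirds_le_log hQ
  by_contra! h
  nlinarith

end Truncation

/-! ### The sums are roots of the normalised trinomial -/

section Roots

variable {m n : ℕ} {c Q : ℝ}

lemma fussCatalanConv_of_rConst_le (hm : 0 < m) (hmn : m < n) (h : rConst m n < c) {β : ℝ}
    (hβ : |β| ≤ 1 / m) : FussCatalanConv (n / m) β (1 / c ^ ((n : ℝ) / m)) := by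
  have hr := rConst_pos hm hmn
  have hc := hr.trans h
  exact (summable_nat_add_iff 1).mp (summable_norm_of_geometric_bound
    (a := fun k => fussCatalan (n / m) β k * (1 / c ^ ((n : ℝ) / m)) ^ k)
    (by positivity : 0 ≤ rConst m n / c) ((div_lt_one hc).mpr h)
    (abs_fussCatalan_mul_pow_le_of_rConst_le hm hmn h.le hβ))

lemma fussCatalanConv_of_lt_rConst (hm : 0 < m) (hmn : m < n) (hc : 0 ≤ c) (h : c < rConst m n) :
    FussCatalanConv (m / n) (1 / n) c := by
  have hr := rConst_pos hm hmn
  exact (summable_nat_add_iff 1).mp (summable_norm_of_geometric_bound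
    (a := fun k => fussCatalan (m / n) (1 / n) k * c ^ k)
    (by positivity : 0 ≤ c / rConst m n) ((div_lt_one hr).mpr h)
    (abs_fussCatalan_mul_pow_le hm hmn hc))

lemma one_le_fussCatalanSum (hm : 0 < m) (hmn : m < n) {z : ℝ} (hz : 0 ≤ z)
    (h : FussCatalanConv (n / m) (1 / m) z) : 1 ≤ fussCatalanSum (n / m) (1 / m) z := by
  rw [h.sum_eq]
  have hm' : (0 : ℝ) < m := by exact_mod_cast hm
  have hα : 1 ≤ (n : ℝ) / m := by
    rw [le_div_iff₀ hm', one_mul]; exact_mod_cast hmn.le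
  refine le_add_of_nonneg_right (tsum_nonneg fun k => mul_nonneg ?_ (by positivity))
  rw [fussCatalan_succ]
  refine mul_nonneg (by positivity) (Finset.prod_nonneg fun j hj => ?_)
  have hjk : (j : ℝ) + 1 ≤ k := by exact_mod_cast Finset.mem_range.mp hj
  have : 0 < 1 / (m : ℝ) := by positivity
  nlinarith

lemma xLow_eq (hm : 0 < m) (hmn : m < n) (h : rConst m n < c) :
    xLow m n c = 1 / c ^ (1 / (m : ℝ)) *
      fussCatalanSum (n / m) (1 / m) (1 / c ^ ((n : ℝ) / m)) := by
  rw [(fussCatalanConv_of_rConst_le hm hmn h (abs_of_nonneg (by positivity)).le).sum_eq, xLow]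
  simp only [lowTerm_succ hm]

lemma xHi_eq (hm : 0 < m) (hmn : m < n) (h : rConst m n < c) :
    xHi m n c = c ^ (1 / ((n - m : ℕ) : ℝ)) *
      fussCatalanSum (n / (n - m : ℕ)) (-(1 / (n - m : ℕ)))
        (1 / c ^ ((n : ℝ) / (n - m : ℕ))) := by
  rw [← rConst_symm hmn] at h
  rw [(fussCatalanConv_of_rConst_le (by omega) (by omega) h
    (by rw [abs_neg]; exact (abs_of_nonneg (by positivity)).le)).sum_eq, xHi]
  simp only [hiTerm_succ hmn, tsum_neg, sub_neg_eq_add, Nat.cast_sub hmn.le]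

lemma xMid_eq (hm : 0 < m) (hmn : m < n) (hc : 0 ≤ c) (h : c < rConst m n) :
    xMid m n c = fussCatalanSum (m / n) (1 / n) c := by
  rw [(fussCatalanConv_of_lt_rConst hm hmn hc h).sum_eq, xMid]
  simp only [midTerm_succ (hm.trans hmn)]

lemma xLow_root (hm : 0 < m) (hmn : m < n) (h : rConst m n < c) :
    0 < xLow m n c ∧ 1 - c * xLow m n c ^ m + xLow m n c ^ n = 0 := by
  have hc : 0 < c := (rConst_pos hm hmn).trans h
  have hm' : (m : ℝ) ≠ 0 := by positivity
  have hconv := fussCatalanConv_of_rConst_le hm hmn h (β := 1 / m)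
    (abs_of_nonneg (by positivity)).le
  have h1 := one_le_fussCatalanSum hm hmn (by positivity) hconv
  have heq := hconv.pow_eq_one_add (a := m) (b := n) (by field_simp) (by field_simp)
  rw [xLow_eq hm hmn h]
  set S := fussCatalanSum (n / m) (1 / m) (1 / c ^ ((n : ℝ) / m))
  refine ⟨by positivity, ?_⟩
  have e1 : (1 / c ^ (1 / (m : ℝ))) ^ m = 1 / c := by
    rw [div_pow, one_pow, ← Real.rpow_mul_natCast hc.le, one_div_mul_cancel hm', Real.rpow_one]
  have e2 : (1 / c ^ (1 / (m : ℝ))) ^ n = 1 / c ^ ((n : ℝ) / m) := by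
    rw [div_pow, one_pow, ← Real.rpow_mul_natCast hc.le, one_div_mul_eq_div]
  rw [mul_pow, mul_pow, e1, e2, heq]
  field_simp
  ring

lemma xHi_root (hm : 0 < m) (hmn : m < n) (h : rConst m n < c) :
    0 < xHi m n c ∧ 1 - c * xHi m n c ^ m + xHi m n c ^ n = 0 := by
  have hc : 0 < c := (rConst_pos hm hmn).trans h
  have hd : 0 < n - m := by omega
  have hdn : n - m < n := by omega
  have hcast : ((n - m : ℕ) : ℝ) = n - m := Nat.cast_sub hmn.le
  have hd' : ((n - m : ℕ) : ℝ) ≠ 0 := by positivity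
  have h' := h
  rw [← rConst_symm hmn] at h'
  have hconv := fussCatalanConv_of_rConst_le hd hdn h' (β := 1 / (n - m : ℕ))
    (abs_of_nonneg (by positivity)).le
  have hconv' := fussCatalanConv_of_rConst_le hd hdn h' (β := -(1 / (n - m : ℕ)))
    (by rw [abs_neg]; exact (abs_of_nonneg (by positivity)).le)
  have h1 := one_le_fussCatalanSum hd hdn (by positivity) hconv
  have hinv := hconv.sum_mul_sum_neg hconv'
  have heq := hconv'.pow_eq_pow_add (a := m) (b := n)
    (by rw [eq_sub_iff_add_eq, ← sub_eq_zero]; field_simp; rw [hcast]; ring) (by field_simp)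
  rw [xHi_eq hm hmn h]
  set S := fussCatalanSum (n / (n - m : ℕ)) (-(1 / (n - m : ℕ)))
    (1 / c ^ ((n : ℝ) / (n - m : ℕ)))
  -- The series for `-β` is the reciprocal of the one for `β`, whose terms are nonnegative.
  have hS : 0 < S := pos_of_mul_pos_right (hinv ▸ one_pos) (by linarith)
  refine ⟨by positivity, ?_⟩
  have e1 : (c ^ (1 / ((n - m : ℕ) : ℝ))) ^ n = c ^ ((n : ℝ) / (n - m : ℕ)) := by
    rw [← Real.rpow_mul_natCast hc.le, one_div_mul_eq_div]
  have e2 : c * (c ^ (1 / ((n - m : ℕ) : ℝ))) ^ m = c ^ ((n : ℝ) / (n - m : ℕ)) := by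
    rw [← Real.rpow_mul_natCast hc.le, one_div_mul_eq_div, ← Real.rpow_one_add' hc.le
      (by positivity)]
    congr 1
    field_simp
    rw [hcast]
    ring
  rw [mul_pow, mul_pow, ← mul_assoc, e1, e2, heq]
  field_simp
  ring

lemma xMid_root (hm : 0 < m) (hmn : m < n) (hc : 0 ≤ c) (h : c < rConst m n) :
    1 ≤ xMid m n c ∧ -1 - c * xMid m n c ^ m + xMid m n c ^ n = 0 := by
  have hn : 0 < n := by omega
  have hn' : (n : ℝ) ≠ 0 := by positivity
  have hconv := fussCatalanConv_of_lt_rConst hm hmn hc h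
  have ha : (n : ℝ) * (1 / n) = 1 := by field_simp
  have hb : (m : ℝ) * (1 / n) = m / n := by field_simp
  have hpos := hconv.sum_pos hc hn.ne' hm.ne' ha hb
  have heq := hconv.pow_eq_one_add ha hb
  rw [xMid_eq hm hmn hc h]
  set S := fussCatalanSum (m / n) (1 / n) c
  refine ⟨?_, by linarith⟩
  refine (one_le_pow_iff_of_nonneg hpos.le hn.ne').mp ?_
  have : 0 ≤ c * S ^ m := by positivity
  linarith

end Roots

/-! ### Relative truncation errors -/

section TruncationError

variable {m n : ℕ} {c Q : ℝ}

lemma abs_lowTerm_succ_le (hm : 0 < m) (hmn : m < n) (h : rConst m n ≤ c) (k : ℕ) :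
    |lowTerm m n c (k + 1)| ≤ n * (rConst m n / c) ^ (k + 1) := by
  rw [lowTerm_succ hm]
  exact abs_fussCatalan_mul_pow_le_of_rConst_le hm hmn h (abs_of_nonneg (by positivity)).le k

lemma abs_hiTerm_succ_le (hm : 0 < m) (hmn : m < n) (h : rConst m n ≤ c) (k : ℕ) :
    |hiTerm m n c (k + 1)| ≤ n * (rConst m n / c) ^ (k + 1) := by
  rw [← rConst_symm hmn] at h ⊢
  rw [hiTerm_succ hmn, abs_neg]
  exact abs_fussCatalan_mul_pow_le_of_rConst_le (by omega) (by omega) h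
    (by rw [abs_neg]; exact (abs_of_nonneg (by positivity)).le) k

lemma abs_midTerm_succ_le (hm : 0 < m) (hmn : m < n) (hc : 0 ≤ c) (k : ℕ) :
    |midTerm m n c (k + 1)| ≤ n * (c / rConst m n) ^ (k + 1) := by
  rw [midTerm_succ (hm.trans hmn)]
  exact abs_fussCatalan_mul_pow_le hm hmn hc k

lemma abs_xLow_sub_xLowTrunc_le (hm : 0 < m) (hmn : m < n) (h : rConst m n < c) (hQ : 2 ≤ Q)
    (hnQ : n ≤ Q) (hρ : rConst m n / c * (Real.log Q + 1) ≤ Real.log Q) {l : ℕ}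
    (hl : 40 * Real.log Q ^ 2 ≤ l) :
    |xLow m n c - xLowTrunc m n c l| ≤ 1 / (36 * Q ^ 4) * xLow m n c := by
  have hr := rConst_pos hm hmn
  have hc := hr.trans h
  have hρ0 : 0 ≤ rConst m n / c := by positivity
  have hconv := fussCatalanConv_of_rConst_le hm hmn h (β := 1 / m)
    (abs_of_nonneg (by positivity)).le
  have h1 := one_le_fussCatalanSum hm hmn (by positivity) hconv
  have herr := abs_tsum_sub_sum_Icc_le n.cast_nonneg hρ0 (lt_one_of_mul_log_le hQ hρ)
    (abs_lowTerm_succ_le hm hmn h.le) l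
  have hfin := herr.trans (geometric_error_le hQ hnQ hρ0 hρ hl
    (S := fussCatalanSum (n / m) (1 / m) (1 / c ^ ((n : ℝ) / m))) (by nlinarith))
  have hx : 0 < 1 / c ^ (1 / (m : ℝ)) := by positivity
  rw [xLow_eq hm hmn h, mul_left_comm, ← xLow_eq hm hmn h, xLow, xLowTrunc, ← mul_sub, abs_mul,
    abs_of_pos hx, add_sub_add_left_eq_sub]
  gcongr

lemma abs_xHi_sub_xHiTrunc_le (hm : 0 < m) (hmn : m < n) (h : rConst m n < c) (hQ : 2 ≤ Q)
    (hnQ : n ≤ Q) (hρ : rConst m n / c * (Real.log Q + 1) ≤ Real.log Q) {l : ℕ}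
    (hl : 40 * Real.log Q ^ 2 ≤ l) :
    |xHi m n c - xHiTrunc m n c l| ≤ 1 / (36 * Q ^ 4) * xHi m n c := by
  have hr := rConst_pos hm hmn
  have hc := hr.trans h
  have hd : 0 < n - m := by omega
  have hdn : n - m < n := by omega
  have hρ0 : 0 ≤ rConst m n / c := by positivity
  have hρ1 := lt_one_of_mul_log_le hQ hρ
  have h' := h
  rw [← rConst_symm hmn] at h'
  have hβ : |1 / ((n - m : ℕ) : ℝ)| ≤ 1 / (n - m : ℕ) := (abs_of_nonneg (by positivity)).le
  have hconv := fussCatalanConv_of_rConst_le hd hdn h' hβ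
  have hconv' := fussCatalanConv_of_rConst_le hd hdn h' (β := -(1 / (n - m : ℕ)))
    (by rwa [abs_neg])
  have h1 := one_le_fussCatalanSum hd hdn (by positivity) hconv
  have hinv := hconv.sum_mul_sum_neg hconv'
  -- The `xHi` sum could be small, so it is bounded below by bounding its reciprocal above, using
  -- the tail estimate with no terms removed.
  have hupper : fussCatalanSum (n / (n - m : ℕ)) (1 / (n - m : ℕ))
      (1 / c ^ ((n : ℝ) / (n - m : ℕ))) ≤ 1 + Q ^ 2 := by
    have hlow := abs_lowTerm_succ_le hd hdn h'.le
    rw [rConst_symm hmn] at hlow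
    have hb := abs_tsum_sub_sum_Icc_le n.cast_nonneg hρ0 hρ1 hlow 0
    simp only [lowTerm_succ hd, Finset.Icc_eq_empty_of_lt one_pos, Finset.sum_empty, sub_zero,
      pow_zero, mul_one] at hb
    have hb' : (n : ℝ) / (1 - rConst m n / c) ≤ Q ^ 2 := by
      have hL := two_thirds_le_log hQ
      have hLQ : Real.log Q ≤ Q - 1 := Real.log_le_sub_one_of_pos (by linarith)
      rw [div_le_iff₀ (by linarith)]
      have : 1 ≤ Q * (1 - rConst m n / c) := by nlinarith
      nlinarith
    rw [hconv.sum_eq]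
    linarith [le_abs_self (∑' k : ℕ, fussCatalan (n / (n - m : ℕ)) (1 / (n - m : ℕ)) (k + 1) *
      (1 / c ^ ((n : ℝ) / (n - m : ℕ))) ^ (k + 1))]
  have herr := abs_tsum_sub_sum_Icc_le n.cast_nonneg hρ0 hρ1 (abs_hiTerm_succ_le hm hmn h.le) l
  have hS := pos_of_mul_pos_right (hinv ▸ one_pos) (zero_le_one.trans h1)
  have hfin := herr.trans (geometric_error_le hQ hnQ hρ0 hρ hl
    (S := fussCatalanSum (n / (n - m : ℕ)) (-(1 / (n - m : ℕ)))
      (1 / c ^ ((n : ℝ) / (n - m : ℕ)))) (hinv.symm.le.trans (by gcongr)))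
  have hx : 0 < c ^ (1 / ((n - m : ℕ) : ℝ)) := by positivity
  rw [xHi_eq hm hmn h, mul_left_comm, ← xHi_eq hm hmn h, xHi, xHiTrunc, ← Nat.cast_sub hmn.le,
    ← mul_sub, abs_mul, abs_of_pos hx, sub_sub_sub_cancel_left, abs_sub_comm]
  gcongr

lemma abs_xMid_sub_xMidTrunc_le (hm : 0 < m) (hmn : m < n) (hc : 0 ≤ c) (h : c < rConst m n)
    (hQ : 2 ≤ Q) (hnQ : n ≤ Q) (hρ : c / rConst m n * (Real.log Q + 1) ≤ Real.log Q) {l : ℕ}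
    (hl : 40 * Real.log Q ^ 2 ≤ l) :
    |xMid m n c - xMidTrunc m n c l| ≤ 1 / (36 * Q ^ 4) * xMid m n c := by
  have hr := rConst_pos hm hmn
  have hρ0 : 0 ≤ c / rConst m n := by positivity
  have h1 := (xMid_root hm hmn hc h).1
  have herr := abs_tsum_sub_sum_Icc_le n.cast_nonneg hρ0 (lt_one_of_mul_log_le hQ hρ)
    (abs_midTerm_succ_le hm hmn hc) l
  have hfin := herr.trans (geometric_error_le hQ hnQ hρ0 hρ hl (S := xMid m n c) (by nlinarith))
  refine le_trans (le_of_eq ?_) hfin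
  rw [xMid, xMidTrunc, add_sub_add_left_eq_sub]

end TruncationError

/-! ### Conclusion -/

section Conclusion

variable {m n : ℕ} {c₁ c₂ c₃ : ℤ} {Q : ℝ}

lemma normCoeff_pos (hc₁ : c₁ ≠ 0) (hc₂ : c₂ < 0) (hc₃ : 0 < c₃) :
    0 < normCoeff m n c₁ c₂ c₃ := by
  have h1 : (c₁ : ℝ) ≠ 0 := by exact_mod_cast hc₁
  have h2 : (c₂ : ℝ) ≠ 0 := by exact_mod_cast hc₂.ne
  have h3 : (c₃ : ℝ) ≠ 0 := by exact_mod_cast hc₃.ne'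
  unfold normCoeff
  positivity

lemma one_div_le_abs_of_not_illConditioned {H : ℕ} (hm : 0 < m) (hmn : m < n) (hc₁ : c₁ ≠ 0)
    (hc₃ : 0 < c₃) (hill : ¬ IllConditioned H m n c₁ c₂ c₃)
    (hne : normCoeff m n c₁ c₂ c₃ ≠ rConst m n) :
    1 / Real.log (n * H) ≤ |normCoeff m n c₁ c₂ c₃ / rConst m n - 1| := by
  by_contra! hlt
  refine hill ⟨by rwa [illConditioned_expr_eq hm hmn], fun ⟨ζ, hζ⟩ => hne ?_⟩
  exact normCoeff_eq_rConst_of_isDegenerateRoot hm hmn hc₁ hc₃ hζ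

lemma isApproximateRoot_of_relative_error (hm : 0 < m) (hmn : m < n) (hc₁ : c₁ ≠ 0)
    (hc₂ : c₂ < 0) (hc₃ : 0 < c₃) (hQ : 2 ≤ Q) (hnQ : n ≤ Q) {σ y y' : ℝ}
    (hσ : (c₁ : ℝ) = |(c₁ : ℝ)| * σ) (hy : 0 < y)
    (hroot : σ - normCoeff m n c₁ c₂ c₃ * y ^ m + y ^ n = 0)
    (hder : normCoeff m n c₁ c₂ c₃ * y ^ m + y ^ n ≤
      3 * Q ^ 2 * |n * y ^ n - m * (normCoeff m n c₁ c₂ c₃ * y ^ m)|)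
    (hy' : |y - y'| ≤ 1 / (36 * Q ^ 4) * y) :
    IsApproximateRoot (realTrinomial m n c₁ c₂ c₃) (rootScale n c₁ c₃ * y')
      (rootScale n c₁ c₃ * y) := by
  have hn : (0 : ℝ) < n := by exact_mod_cast hm.trans hmn
  have hQ4 : Q ≤ Q ^ 4 := le_self_pow₀ (by linarith) (by norm_num)
  refine isApproximateRoot_rootScale_mul hm hmn hc₁ hc₂ hc₃ hσ hy (by positivity) hroot hder hy'
    ?_ ?_
  · gcongr
    linarith
  -- With `D = 3 Q ^ 2`, the relative error `1 / (36 Q ^ 4)` makes the product exactly 1.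
  · calc 12 * (n : ℝ) ^ 2 * (3 * Q ^ 2) * (1 / (36 * Q ^ 4))
        ≤ 12 * Q ^ 2 * (3 * Q ^ 2) * (1 / (36 * Q ^ 4)) := by gcongr
      _ = 1 := by field_simp; norm_num

end Conclusion

theorem lemma2 :
    ∃ K : ℝ, 0 < K ∧
      ∀ (H a₂ a₃ : ℕ) (c₁ c₂ c₃ : ℤ),
        0 < a₂ → a₂ < a₃ →
        c₁ ≠ 0 → |c₁| ≤ (H : ℤ) → |c₂| ≤ (H : ℤ) → |c₃| ≤ (H : ℤ) →
        c₂ < 0 → 0 < c₃ →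
        ¬ IllConditioned H a₂ a₃ c₁ c₂ c₃ →
        (0 < c₁ → rConst a₂ a₃ < normCoeff a₂ a₃ c₁ c₂ c₃ →
          (Summable fun k : ℕ => lowTerm a₂ a₃ (normCoeff a₂ a₃ c₁ c₂ c₃) (k + 1)) ∧
          (Summable fun k : ℕ => hiTerm a₂ a₃ (normCoeff a₂ a₃ c₁ c₂ c₃) (k + 1)) ∧
          ∀ l : ℕ, K * Real.log (a₃ * H) ^ 2 ≤ l →
            IsApproximateRoot (realTrinomial a₂ a₃ c₁ c₂ c₃)
              (rootScale a₃ c₁ c₃ * xLowTrunc a₂ a₃ (normCoeff a₂ a₃ c₁ c₂ c₃) l)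
              (rootScale a₃ c₁ c₃ * xLow a₂ a₃ (normCoeff a₂ a₃ c₁ c₂ c₃)) ∧
            IsApproximateRoot (realTrinomial a₂ a₃ c₁ c₂ c₃)
              (rootScale a₃ c₁ c₃ * xHiTrunc a₂ a₃ (normCoeff a₂ a₃ c₁ c₂ c₃) l)
              (rootScale a₃ c₁ c₃ * xHi a₂ a₃ (normCoeff a₂ a₃ c₁ c₂ c₃))) ∧
        (c₁ < 0 → normCoeff a₂ a₃ c₁ c₂ c₃ < rConst a₂ a₃ →
          (Summable fun k : ℕ => midTerm a₂ a₃ (normCoeff a₂ a₃ c₁ c₂ c₃) (k + 1)) ∧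
          ∀ l : ℕ, K * Real.log (a₃ * H) ^ 2 ≤ l →
            IsApproximateRoot (realTrinomial a₂ a₃ c₁ c₂ c₃)
              (rootScale a₃ c₁ c₃ * xMidTrunc a₂ a₃ (normCoeff a₂ a₃ c₁ c₂ c₃) l)
              (rootScale a₃ c₁ c₃ * xMid a₂ a₃ (normCoeff a₂ a₃ c₁ c₂ c₃))) := by
  refine ⟨40, by norm_num, ?_⟩
  intro H m n c₁ c₂ c₃ hm hmn hc₁ hH _ _ hc₂ hc₃ hill
  have hH1 : (1 : ℝ) ≤ H := by
    have : (1 : ℤ) ≤ H := (Int.one_le_abs hc₁).trans hH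
    exact_mod_cast this
  have hm1 : (1 : ℝ) ≤ m := by exact_mod_cast hm
  have hmn1 : (m : ℝ) + 1 ≤ n := by exact_mod_cast hmn
  have hnQ : (n : ℝ) ≤ n * H := le_mul_of_one_le_right (by linarith) hH1
  have hsep := one_div_le_abs_of_not_illConditioned hm hmn hc₁ hc₃ hill
  have hQ : (2 : ℝ) ≤ n * H := by linarith
  set Q : ℝ := n * H
  have hL := two_thirds_le_log hQ
  have hL0 : 0 < Real.log Q := by linarith
  have hLQ : Real.log Q + 1 ≤ Q := by
    linarith [Real.log_le_sub_one_of_pos (by linarith : 0 < Q)]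
  have hc : 0 < normCoeff m n c₁ c₂ c₃ := normCoeff_pos hc₁ hc₂ hc₃
  have hr := rConst_pos hm hmn
  refine ⟨fun hpos hlt => ?_, fun hneg hlt => ?_⟩
  · have hsep := hsep hlt.ne'
    have hσ : (c₁ : ℝ) = |(c₁ : ℝ)| * 1 := by
      rw [mul_one, abs_of_pos (by exact_mod_cast hpos)]
    set c := normCoeff m n c₁ c₂ c₃
    -- This is `c / r - 1 ≥ 1 / log Q` with denominators cleared.
    have hcΛ : rConst m n * (Real.log Q + 1) ≤ c * Real.log Q := by
      rw [abs_of_pos (sub_pos.mpr ((one_lt_div hr).mpr hlt)), div_sub_one hr.ne',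
        div_le_div_iff₀ hL0 hr] at hsep
      linarith
    have hρ : rConst m n / c * (Real.log Q + 1) ≤ Real.log Q := by
      rw [div_mul_eq_mul_div, div_le_iff₀ hc]
      linarith
    have hρ1 := lt_one_of_mul_log_le hQ hρ
    have hder {y : ℝ} (hy : 0 < y) (hroot : 1 - c * y ^ m + y ^ n = 0) :
        c * y ^ m + y ^ n ≤ 3 * Q ^ 2 * |n * y ^ n - m * (c * y ^ m)| := by
      refine (add_le_mul_abs_sub hm hmn hy hroot hL0 hcΛ).trans ?_
      have : 3 * (n : ℝ) * (Real.log Q + 1) ≤ 3 * Q * Q := by gcongr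
      refine mul_le_mul_of_nonneg_right (this.trans (by nlinarith)) (abs_nonneg _)
    refine ⟨Summable.of_norm (summable_norm_of_geometric_bound (by positivity) hρ1
        (abs_lowTerm_succ_le hm hmn hlt.le)),
      Summable.of_norm (summable_norm_of_geometric_bound (by positivity) hρ1
        (abs_hiTerm_succ_le hm hmn hlt.le)), fun l hl => ⟨?_, ?_⟩⟩
    · obtain ⟨hy, hroot⟩ := xLow_root hm hmn hlt
      exact isApproximateRoot_of_relative_error hm hmn hc₁ hc₂ hc₃ hQ hnQ hσ hy hroot
        (hder hy hroot) (abs_xLow_sub_xLowTrunc_le hm hmn hlt hQ hnQ hρ hl)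
    · obtain ⟨hy, hroot⟩ := xHi_root hm hmn hlt
      exact isApproximateRoot_of_relative_error hm hmn hc₁ hc₂ hc₃ hQ hnQ hσ hy hroot
        (hder hy hroot) (abs_xHi_sub_xHiTrunc_le hm hmn hlt hQ hnQ hρ hl)
  · have hsep := hsep hlt.ne
    have hσ : (c₁ : ℝ) = |(c₁ : ℝ)| * (-1) := by
      rw [abs_of_neg (by exact_mod_cast hneg)]
      ring
    set c := normCoeff m n c₁ c₂ c₃
    have hρ : c / rConst m n * (Real.log Q + 1) ≤ Real.log Q := by
      rw [abs_of_neg (sub_neg.mpr ((div_lt_one hr).mpr hlt)), neg_sub, div_le_iff₀ hL0] at hsep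
      have : c / rConst m n ≤ 1 := (div_le_one hr).mpr hlt.le
      linarith
    have hρ1 := lt_one_of_mul_log_le hQ hρ
    refine ⟨Summable.of_norm (summable_norm_of_geometric_bound (by positivity) hρ1
        (abs_midTerm_succ_le hm hmn hc.le)), fun l hl => ?_⟩
    obtain ⟨hy, hroot⟩ := xMid_root hm hmn hc.le hlt
    refine isApproximateRoot_of_relative_error hm hmn hc₁ hc₂ hc₃ hQ hnQ hσ (by linarith) hroot
      ?_ (abs_xMid_sub_xMidTrunc_le hm hmn hc.le hlt hQ hnQ hρ hl)
    have hv : 1 ≤ xMid m n c ^ n := one_le_pow₀ hy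
    set v := xMid m n c ^ n
    have hcv : c * xMid m n c ^ m = v - 1 := by linarith
    rw [hcv]
    -- No separation from `r` is needed here: the expression equals `(n - m) v + m`.
    have habs : v ≤ |n * v - m * (v - 1)| := by
      refine le_trans ?_ (le_abs_self _)
      nlinarith
    calc v - 1 + v ≤ 3 * 1 * v := by linarith
      _ ≤ 3 * Q ^ 2 * |n * v - m * (v - 1)| := by
        gcongr
        nlinarith
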